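/- Let $1<p<q$ be real, let $\rho,\mu,v_p,v_q:\mathbb{R}^3\to(0,\infty)$ be radially symmetric $C^2$-functions, and let $M:\mathbb{R}^3\to\mathbb{R}^{3\times3}$ be an arbitrary matrix function. Consider the curl-curl wave equation $$\rho(x)\mathbf u_{tt}+\nabla\times\big(M(x)\nabla\times\mathbf u\big)+\mu(x)\mathbf u+v_p(x)|\mathbf u|^{p-1}\mathbf u+v_q(x)|\mathbf u|^{q-1}\mathbf u=0,\qquad (x,t)\in\mathbb{R}^3\times\mathbb{R}.\tag{1}$$ Put $\sigma(x)=(\mu(x)/\rho(x))^{1/2}$, $\tau(x)=(\mu(x)/v_q(x))^{1/(q-1)}$ and $T=2\pi\sigma(0)$. Assume (V) $v_p(x)=\left(\mu(x)^{q-p}/v_q(x)^{1-p}\right)^{1/(q-1)}$ for all $x\in\mathbb{R}^3$; (H1) $\sigma(0)\sigma(x)<1$ for all $x\in\mathbb{R}^3\setminus\{0\}$; (H2) the function $U(x)=|1-\sigma(0)\sigma(x)|^{1/(q-1)}$ satisfies $U(x)\to0$, $\nabla U(x)\to0$ and $D^2U(x)\to0$ as $x\to0$, $x\neq0$; (H3)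 $\sup_{x\in\mathbb{R}^3}|1-\sigma(0)\sigma(x)|e^{\gamma(q-1)|x|}<\infty$ for a given $\gamma>0$; (H4) $\sup_{x\in\mathbb{R}^3}\tau(x)<\infty$. By a breather (of period $T$ and rate $\gamma$) we mean a function $\mathbf u\in C^2(\mathbb{R}^3\times\mathbb{R};\mathbb{R}^3)$, not identically zero, that satisfies (1) pointwise (with $M\nabla\times\mathbf u$ differentiable in $x$), is $T$-periodic in $t$, and satisfies $\sup_{\mathbb{R}^3\times\mathbb{R}}|\mathbf u(x,t)|e^{\gamma|x|}<\infty$. Then $T=2\pi\sqrt{\rho(0)/\mu(0)}$, and there exists a breather $\mathbf u$ of the form $\mathbf u(x,t)=y(|x|,t)\,x/|x|$ for $x\ne0$, $\mathbf u(0,t)=0$, with $y\in C^2([0,\infty)\times\mathbb{R})$. Moreover, for every radially symmetric $C^2$-function $b:\mathbb{R}^3\to\mathbb{R}$ the phase-shifted function $\mathbf u_b(x,t)=\mathbf u(x,t+b(x))$ is again a breather (of the same period and rate), and the set of all functions $\mathbf u_b$ so obtained has at least the cardinality of the continuum. -/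

import Mathlib

open scoped ContDiff Topology

noncomputable section

namespace CurlCurl

/-- Three-dimensional Euclidean space. -/
abbrev E3 : Type := EuclideanSpace ℝ (Fin 3)

/-- A function on `ℝ³` is radially symmetric if its value depends only on `‖x‖`. -/
def RadiallySymmetric (f : E3 → ℝ) : Prop :=
  ∀ x y : E3, ‖x‖ = ‖y‖ → f x = f y

/-- The partial derivative `∂ⱼ Fᵢ` of a vector field at `x`. -/
def partialDeriv (F : E3 → E3) (j i : Fin 3) (x : E3) : ℝ :=
  (fderiv ℝ F x (EuclideanSpace.single j 1)) i

/-- The curl `∇ × F` of a vector field on `ℝ³`. -/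
def curl (F : E3 → E3) (x : E3) : E3 :=
  !₂[partialDeriv F 1 2 x - partialDeriv F 2 1 x,
     partialDeriv F 2 0 x - partialDeriv F 0 2 x,
     partialDeriv F 0 1 x - partialDeriv F 1 0 x]

/-- The field `M(x) ∇ × F`. -/
def matCurl (M : E3 → Matrix (Fin 3) (Fin 3) ℝ) (F : E3 → E3) (x : E3) : E3 :=
  Matrix.toEuclideanLin (M x) (curl F x)

/-- `u ∈ C²(ℝ³ × ℝ)` solves
`ρ u_tt + ∇ × (M ∇ × u) + μ u + v_p |u|^(p-1) u + v_q |u|^(q-1) u = 0` pointwise on `ℝ³ × ℝ`;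
the field `M ∇ × u` is required to be differentiable, so that its curl is a genuine one. -/
structure IsClassicalSolution (ρ μ vp vq : E3 → ℝ) (M : E3 → Matrix (Fin 3) (Fin 3) ℝ) (p q : ℝ)
    (u : E3 → ℝ → E3) : Prop where
  contDiff : ContDiff ℝ 2 (fun z : E3 × ℝ => u z.1 z.2)
  differentiable_matCurl : ∀ t : ℝ, Differentiable ℝ (matCurl M (fun x => u x t))
  equation : ∀ (x : E3) (t : ℝ),
    ρ x • iteratedDeriv 2 (u x) t + curl (matCurl M (fun z => u z t)) x + μ x • u x t
      + (vp x * ‖u x t‖ ^ (p - 1)) • u x t + (vq x * ‖u x t‖ ^ (q - 1)) • u x t = 0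

/-- A `T`-periodic breather with exponential localization rate `γ`: a classical solution, not
identically zero, `T`-periodic in time, with `sup |u(x,t)| e^(γ|x|) < ∞`. -/
structure IsBreather (ρ μ vp vq : E3 → ℝ) (M : E3 → Matrix (Fin 3) (Fin 3) ℝ) (p q T γ : ℝ)
    (u : E3 → ℝ → E3) : Prop where
  isClassicalSolution : IsClassicalSolution ρ μ vp vq M p q u
  nontrivial : ∃ (x : E3) (t : ℝ), u x t ≠ 0
  periodic : ∀ x : E3, Function.Periodic (u x) T
  localized : BddAbove (Set.range fun z : E3 × ℝ => ‖u z.1 z.2‖ * Real.exp (γ * ‖z.1‖))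

/-- `τ = (μ / v_q)^(1/(q-1))`. -/
def tau (μ vq : E3 → ℝ) (q : ℝ) (x : E3) : ℝ :=
  (μ x / vq x) ^ (1 / (q - 1))

/-- `σ = (μ / ρ)^(1/2)`. -/
def sigma (ρ μ : E3 → ℝ) (x : E3) : ℝ :=
  √(μ x / ρ x)

/-- `U(x) → 0` in the `C²`-sense as `x → 0`: `U`, `∇U` and `D²U` tend to `0` as `x → 0`,
`x ≠ 0`. -/
def TendstoZeroC2 (U : E3 → ℝ) : Prop :=
  Filter.Tendsto U (𝓝[≠] 0) (𝓝 0) ∧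
  Filter.Tendsto (fderiv ℝ U) (𝓝[≠] 0) (𝓝 0) ∧
  Filter.Tendsto (fderiv ℝ (fderiv ℝ U)) (𝓝[≠] 0) (𝓝 0)

/-- The phase-shifted field `u_b(x,t) = u(x, t + b(x))`. -/
def phaseShift (u : E3 → ℝ → E3) (b : E3 → ℝ) : E3 → ℝ → E3 :=
  fun x t => u x (t + b x)

end CurlCurl

end

/-!
The assumption `U → 0` forces `σ 0 = 1`. A radial field `f(|x|, t) x / |x|` is curl-free, so the
matrix `M` drops out, and after the scaling `u = τ(x) w(σ(x) t) x / |x|` the equation becomes the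
same autonomous oscillator `w'' + w + |w| ^ (p - 1) w + |w| ^ (q - 1) w = 0` at every point `x`.
The period of the oscillator decreases continuously from `2π` at amplitude zero to `0`, so at each
`x` the amplitude can be chosen so that the period is `2π σ(x)`, making `u` exactly `2π`-periodic.
In polar form `w = R sin φ`, the angle `φ` depends smoothly on the powers `R ^ ((p - 1) / 2)` and
`R ^ ((q - p) / 2)`, and by (H2) the amplitude vanishes at the origin to second order, which
compensates both the singularity of these powers and that of `x / |x|`.
-/

noncomputable section

namespace CurlCurl

section ParametricIntegral

variable {E F : Type*} [NormedAddCommGroup E] [NormedSpace ℝ E]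
  [NormedAddCommGroup F] [NormedSpace ℝ F]

theorem hasFDerivAt_intervalIntegral_of_continuous [ProperSpace E] {f : E → ℝ → F}
    {f' : E → ℝ → E →L[ℝ] F} (hf : Continuous (Function.uncurry f))
    (hf' : Continuous (Function.uncurry f'))
    (hd : ∀ z φ, HasFDerivAt (fun z => f z φ) (f' z φ) z) (a b : ℝ) (z : E) :
    HasFDerivAt (fun z => ∫ φ in a..b, f z φ) (∫ φ in a..b, f' z φ) z := by
  obtain ⟨C, hC⟩ := ((isCompact_closedBall z 1).prod isCompact_uIcc).exists_bound_of_continuousOn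
    (f := Function.uncurry f') (s := Metric.closedBall z 1 ×ˢ Set.uIcc a b) hf'.continuousOn
  exact intervalIntegral.hasFDerivAt_integral_of_dominated_of_fderiv_le
    (Metric.closedBall_mem_nhds z one_pos) (bound := fun _ => C)
    (.of_forall fun w => (hf.uncurry_left w).aestronglyMeasurable)
    ((hf.uncurry_left z).intervalIntegrable _ _)
    (hf'.uncurry_left z).aestronglyMeasurable
    (.of_forall fun φ hφ w hw => hC (w, φ) ⟨hw, Set.uIoc_subset_uIcc hφ⟩)
    intervalIntegrable_const (.of_forall fun φ _ w _ => hd w φ)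

theorem hasDerivAt_intervalIntegral_comp [ProperSpace E] {H : Type*} [NormedAddCommGroup H]
    [NormedSpace ℝ H] {g : E × H → F} (hg : ContDiff ℝ 1 g) {κ : ℝ → H} (hκ : Continuous κ)
    {c : ℝ → E} {c' : E} {r : ℝ} (hc : HasDerivAt c c' r) {d : ℝ → F}
    (hd : ∀ φ, HasDerivAt (fun r => g (c r, κ φ)) (d φ) r) (a b : ℝ) :
    HasDerivAt (fun r => ∫ φ in a..b, g (c r, κ φ)) (∫ φ in a..b, d φ) r := by
  have hg' : Continuous (Function.uncurry fun z φ =>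
      (fderiv ℝ g (z, κ φ)).comp (ContinuousLinearMap.inl ℝ E H)) :=
    ((hg.continuous_fderiv one_ne_zero).comp
      (continuous_fst.prodMk (hκ.comp continuous_snd))).clm_comp continuous_const
  have hpartial : ∀ z φ, HasFDerivAt (fun z => g (z, κ φ))
      ((fderiv ℝ g (z, κ φ)).comp (ContinuousLinearMap.inl ℝ E H)) z := fun z φ =>
    HasFDerivAt.comp (g := g) z (hg.differentiable one_ne_zero (z, κ φ)).hasFDerivAt
      (hasFDerivAt_prodMk_left z (κ φ))
  have hint := (hasFDerivAt_intervalIntegral_of_continuous (f := fun z φ => g (z, κ φ))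
    (hg.continuous.comp (continuous_fst.prodMk (hκ.comp continuous_snd))) hg' hpartial
    a b (c r)).comp_hasDerivAt r hc
  refine hint.congr_deriv ((ContinuousLinearMap.intervalIntegral_apply
    ((hg'.uncurry_left (c r)).intervalIntegrable _ _) _).trans ?_)
  exact intervalIntegral.integral_congr fun φ _ =>
    ((hpartial (c r) φ).comp_hasDerivAt r hc).unique (hd φ)

theorem norm_intervalIntegral_sub_smul_le {f : ℝ → F} [CompleteSpace F] {a b ε : ℝ} {y : F}
    (hf : Continuous f) (h : ∀ φ ∈ Set.uIcc a b, ‖f φ - y‖ ≤ ε) :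
    ‖(∫ φ in a..b, f φ) - (b - a) • y‖ ≤ ε * |b - a| := by
  have hsub : (∫ φ in a..b, f φ) - (b - a) • y = ∫ φ in a..b, (f φ - y) := by
    rw [intervalIntegral.integral_sub (hf.intervalIntegrable _ _) intervalIntegrable_const,
      intervalIntegral.integral_const]
  rw [hsub]
  exact intervalIntegral.norm_integral_le_of_norm_le_const fun φ hφ =>
    h φ (Set.uIoc_subset_uIcc hφ)

theorem hasFDerivAt_intervalIntegral_snd [CompleteSpace F] {f : E → ℝ → F}
    (hf : Continuous (Function.uncurry f)) (z : E) (θ : ℝ) :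
    HasFDerivAt (fun w : E × ℝ => ∫ φ in θ..w.2, f w.1 φ)
      ((ContinuousLinearMap.toSpanSingleton ℝ (f z θ)).comp (ContinuousLinearMap.snd ℝ E ℝ))
      (z, θ) := by
  rw [hasFDerivAt_iff_isLittleO, Asymptotics.isLittleO_iff]
  intro ε hε
  obtain ⟨δ, hδ, hball⟩ := Metric.continuousAt_iff.1 (hf.continuousAt (x := (z, θ))) ε hε
  filter_upwards [Metric.ball_mem_nhds (z, θ) hδ] with v hv
  obtain ⟨hv₁, hv₂⟩ : dist v.1 z < δ ∧ dist v.2 θ < δ := by simpa [Prod.dist_eq] using hv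
  have hclose : ∀ φ ∈ Set.uIcc θ v.2, ‖f v.1 φ - f z θ‖ ≤ ε := fun φ hφ => by
    have hφ' : dist φ θ < δ := lt_of_le_of_lt (Set.abs_sub_left_of_mem_uIcc hφ) hv₂
    rw [← dist_eq_norm]
    exact (hball (x := (v.1, φ)) (max_lt hv₁ hφ')).le
  simpa using (norm_intervalIntegral_sub_smul_le (hf.uncurry_left v.1) hclose).trans
    (mul_le_mul_of_nonneg_left (norm_snd_le (v - (z, θ))) hε.le)

theorem hasFDerivAt_primitive_of_continuous [ProperSpace E] [CompleteSpace F] {f : E → ℝ → F}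
    {f' : E → ℝ → E →L[ℝ] F} (hf : Continuous (Function.uncurry f))
    (hf' : Continuous (Function.uncurry f'))
    (hd : ∀ z φ, HasFDerivAt (fun z => f z φ) (f' z φ) z) (a : ℝ) (w : E × ℝ) :
    HasFDerivAt (fun w : E × ℝ => ∫ φ in a..w.2, f w.1 φ)
      ((∫ φ in a..w.2, f' w.1 φ).coprod (ContinuousLinearMap.toSpanSingleton ℝ (f w.1 w.2))) w := by
  obtain ⟨z, θ⟩ := w
  have hsplit : (fun w : E × ℝ => ∫ φ in a..w.2, f w.1 φ)
      = (fun w => ∫ φ in a..θ, f w.1 φ) + fun w => ∫ φ in θ..w.2, f w.1 φ := by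
    ext w
    have hint := fun b c => (hf.uncurry_left w.1).intervalIntegrable (μ := MeasureTheory.volume) b c
    exact (intervalIntegral.integral_add_adjacent_intervals (hint _ _) (hint _ _)).symm
  have hparam : HasFDerivAt (fun w : E × ℝ => ∫ φ in a..θ, f w.1 φ)
      ((∫ φ in a..θ, f' z φ).comp (ContinuousLinearMap.fst ℝ E ℝ)) (z, θ) :=
    HasFDerivAt.comp (g := fun z => ∫ φ in a..θ, f z φ) (z, θ)
      (hasFDerivAt_intervalIntegral_of_continuous hf hf' hd a θ z) hasFDerivAt_fst
  rw [hsplit]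
  exact (hparam.add (hasFDerivAt_intervalIntegral_snd hf z θ)).congr_fderiv (by ext <;> simp)

theorem continuous_primitive {X : Type*} [TopologicalSpace X] {f : X → ℝ → F}
    (hf : Continuous (Function.uncurry f)) (a : ℝ) :
    Continuous fun w : X × ℝ => ∫ φ in a..w.2, f w.1 φ :=
  intervalIntegral.continuous_parametric_intervalIntegral_of_continuous
    (f := fun (w : X × ℝ) φ => f w.1 φ) (by fun_prop) continuous_snd

variable [ProperSpace E] [CompleteSpace F]

theorem contDiff_succ_primitive {f : E → ℝ → F} {f' : E → ℝ → E →L[ℝ] F} {n : ℕ}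
    (hf : ContDiff ℝ n (Function.uncurry f)) (hf' : Continuous (Function.uncurry f'))
    (hd : ∀ z φ, HasFDerivAt (fun z => f z φ) (f' z φ) z) (a : ℝ)
    (hint : ContDiff ℝ n fun w : E × ℝ => ∫ φ in a..w.2, f' w.1 φ) :
    ContDiff ℝ (n + 1) fun w : E × ℝ => ∫ φ in a..w.2, f w.1 φ := by
  refine contDiff_succ_iff_hasFDerivAt.2
    ⟨_, ?_, hasFDerivAt_primitive_of_continuous hf.continuous hf' hd a⟩
  exact (ContinuousLinearMap.coprodEquivL (𝕜 := ℝ) (E := E) (F := ℝ) (G := F) ℝ).contDiff.comp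
    (hint.prodMk ((ContinuousLinearMap.toSpanSingletonCLE (𝕜 := ℝ) (E := F)).contDiff.comp hf))

theorem contDiff_one_primitive {f : E → ℝ → F} (hf : ContDiff ℝ 1 (Function.uncurry f)) (a : ℝ) :
    ContDiff ℝ 1 fun w : E × ℝ => ∫ φ in a..w.2, f w.1 φ := by
  have hf' : Continuous (Function.uncurry fun z φ =>
      (fderiv ℝ (Function.uncurry f) (z, φ)).comp (ContinuousLinearMap.inl ℝ E ℝ)) :=
    (hf.continuous_fderiv one_ne_zero).clm_comp continuous_const
  refine contDiff_succ_primitive (n := 0) (contDiff_zero.2 hf.continuous) hf' (fun z φ => ?_) a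
    (contDiff_zero.2 (continuous_primitive hf' a))
  exact HasFDerivAt.comp (g := Function.uncurry f) (f := fun e => (e, φ)) z
    (hf.differentiable one_ne_zero (z, φ)).hasFDerivAt (hasFDerivAt_prodMk_left z φ)

/-- A derivative in the end point uses up the integral, so `κ` may be one order less smooth. -/
theorem contDiff_two_primitive {H : Type*} [NormedAddCommGroup H] [NormedSpace ℝ H]
    {g : E × H → F} (hg : ContDiff ℝ 2 g) {κ : ℝ → H} (hκ : ContDiff ℝ 1 κ) (a : ℝ) :
    ContDiff ℝ 2 fun w : E × ℝ => ∫ φ in a..w.2, g (w.1, κ φ) := by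
  have hpair : ContDiff ℝ 1 fun w : E × ℝ => (w.1, κ w.2) :=
    contDiff_fst.prodMk (hκ.comp contDiff_snd)
  have hg' : ContDiff ℝ 1 (Function.uncurry fun z φ =>
      (fderiv ℝ g (z, κ φ)).comp (ContinuousLinearMap.inl ℝ E H)) :=
    ((hg.fderiv_right (m := 1) one_add_one_eq_two.le).comp hpair).clm_comp contDiff_const
  refine contDiff_succ_primitive (f := fun z φ => g (z, κ φ)) (n := 1)
    ((hg.of_le one_le_two).comp hpair) hg'.continuous (fun z φ => ?_) a
    (contDiff_one_primitive hg' a)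
  exact HasFDerivAt.comp (g := g) z (hg.differentiable two_ne_zero (z, κ φ)).hasFDerivAt
    (hasFDerivAt_prodMk_left z (κ φ))

end ParametricIntegral

theorem contDiffAt_of_implicit_eq {E : Type*} [NormedAddCommGroup E] [NormedSpace ℝ E]
    [CompleteSpace E] {n : WithTop ℕ∞} {f : E × ℝ → ℝ} {u : E × ℝ} {g : E → ℝ}
    (hf : ContDiffAt ℝ n f u) (hn : n ≠ 0) (hf' : fderiv ℝ f u (0, 1) ≠ 0)
    (hg : ∀ᶠ v in 𝓝 u, f v = f u → g v.1 = v.2) : ContDiffAt ℝ n g u.1 := by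
  have hinv : (fderiv ℝ f u ∘L .inr ℝ E ℝ).IsInvertible :=
    ⟨.unitsEquivAut ℝ (Units.mk0 _ hf'), by ext; simp⟩
  set ψ := hf.implicitFunction hn hinv
  have hψ : ContDiffAt ℝ n ψ u.1 := hf.contDiffAt_implicitFunction hn hinv
  have hgraph : Filter.Tendsto (fun x => (x, ψ x)) (𝓝 u.1) (𝓝 u) := by
    have := (continuousAt_id.prodMk hψ.continuousAt).tendsto
    rwa [show ψ u.1 = u.2 from hf.implicitFunction_apply_self hn hinv] at this
  refine hψ.congr_of_eventuallyEq ?_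
  filter_upwards [hf.eventually_apply_implicitFunction hn hinv, hgraph.eventually hg]
    with x hx hgx
  exact hgx hx

section AngularWeight

theorem contDiff_dslope {F : Type*} [NormedAddCommGroup F] [NormedSpace ℝ F] [CompleteSpace F]
    {n : WithTop ℕ∞} {f : ℝ → F} {a : ℝ}
    (hf : ContDiff ℝ n f) (ha : AnalyticAt ℝ f a) : ContDiff ℝ n (dslope f a) := by
  refine contDiff_iff_contDiffAt.2 fun v => ?_
  rcases eq_or_ne v a with rfl | hv
  · obtain ⟨s, hs⟩ := ha
    exact AnalyticAt.contDiffAt ⟨_, hs.has_fpower_series_dslope_fslope⟩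
  · have h : ContDiffAt ℝ n (fun v => (v - a)⁻¹ • (f v - f a)) v :=
      ((contDiffAt_id.sub contDiffAt_const).inv (sub_ne_zero.2 hv)).smul
        (hf.contDiffAt.sub contDiffAt_const)
    refine h.congr_of_eventuallyEq ?_
    filter_upwards [isOpen_ne.mem_nhds hv] with w hw
    rw [dslope_of_ne _ hw, slope_def_module]

theorem contDiff_dslope_rpow {m : ℝ} (hm : 1 ≤ m) :
    ContDiff ℝ 1 (dslope (fun v : ℝ => v ^ m) 1) :=
  contDiff_dslope (Real.contDiff_rpow_const_of_le (by simpa using hm))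
    (Real.contDiffAt_rpow_const_of_ne one_ne_zero).analyticAt

theorem dslope_rpow_pos {m : ℝ} (hm : 0 < m) {v : ℝ} (hv : 0 ≤ v) :
    0 < dslope (fun v : ℝ => v ^ m) 1 v := by
  rcases eq_or_ne v 1 with rfl | h
  · simpa [dslope_same, Real.deriv_rpow_const] using hm
  · rw [dslope_of_ne _ h]
    exact (Real.strictMonoOn_rpow_Ici_of_exponent_pos hm).slope_pos (zero_le_one' ℝ) hv h.symm

theorem sub_mul_deriv_dslope_rpow {m : ℝ} (hm : 1 ≤ m) (v : ℝ) :
    (v - 1) * deriv (dslope (fun v : ℝ => v ^ m) 1) v + dslope (fun v : ℝ => v ^ m) 1 v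
      = m * v ^ (m - 1) := by
  have hd := ((contDiff_dslope_rpow hm).differentiable one_ne_zero v).hasDerivAt
  have hprod := ((hasDerivAt_id v).sub_const 1).mul hd
  have hpow := (Real.hasDerivAt_rpow_const (x := v) (Or.inr hm)).sub_const 1
  have heq : (fun v : ℝ => v ^ m - 1) = (fun v => id v - 1) * dslope (fun v : ℝ => v ^ m) 1 := by
    ext v
    simpa using (sub_smul_dslope (fun v : ℝ => v ^ m) 1 v).symm
  rw [heq] at hpow
  simpa [add_comm] using hprod.unique hpow

theorem sq_rpow_half (x m : ℝ) : (x ^ 2) ^ (m / 2) = |x| ^ m := by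
  rw [← sq_abs, ← Real.rpow_natCast, ← Real.rpow_mul (abs_nonneg _)]
  congr 1
  push_cast
  ring

/-- The squared angular weight `j_p²` of the power `|w|^(p-1) w`. It is normalized by
`j_p² cos² = 2 / (p + 1) (1 - |sin|^(p+1))`, so that the potential energy missing at the angle `φ`
is carried by the velocity; the division by `cos²` is a divided difference. -/
def angularWeightSq (p φ : ℝ) : ℝ :=
  2 / (p + 1) * dslope (fun v : ℝ => v ^ ((p + 1) / 2)) 1 (Real.sin φ ^ 2)

/-- The angular weight `j_p` of the power `|w|^(p-1) w`. -/
def angularWeight (p φ : ℝ) : ℝ := √(angularWeightSq p φ)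

theorem angularWeight_periodic (p : ℝ) : Function.Periodic (angularWeight p) (2 * Real.pi) :=
  fun φ => by simp [angularWeight, angularWeightSq]

variable {p : ℝ} (hp : 1 < p)
include hp

theorem angularWeightSq_pos (φ : ℝ) : 0 < angularWeightSq p φ :=
  mul_pos (by positivity) (dslope_rpow_pos (by linarith) (sq_nonneg _))

theorem angularWeight_sq (φ : ℝ) : angularWeight p φ ^ 2 = angularWeightSq p φ :=
  Real.sq_sqrt (angularWeightSq_pos hp φ).le

theorem contDiff_angularWeight : ContDiff ℝ 1 (angularWeight p) :=
  (contDiff_const.mul ((contDiff_dslope_rpow (by linarith)).comp (Real.contDiff_sin.pow 2))).sqrt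
    fun φ => (angularWeightSq_pos hp φ).ne'

theorem angularWeight_mul_deriv (φ : ℝ) :
    angularWeight p φ * deriv (angularWeight p) φ = 2 / (p + 1) *
      deriv (dslope (fun v : ℝ => v ^ ((p + 1) / 2)) 1) (Real.sin φ ^ 2)
        * (Real.sin φ * Real.cos φ) := by
  have hj := ((contDiff_angularWeight hp).differentiable one_ne_zero φ).hasDerivAt.pow 2
  have hD := ((((contDiff_dslope_rpow (m := (p + 1) / 2) (by linarith)).differentiable
    one_ne_zero (Real.sin φ ^ 2)).hasDerivAt.comp φ
      ((Real.hasDerivAt_sin φ).pow 2)).const_mul (2 / (p + 1)))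
  have h := hj.unique (hD.congr_of_eventuallyEq (.of_forall (angularWeight_sq hp)))
  simp only [Nat.cast_ofNat, Nat.reduceSub, pow_one] at h
  linear_combination h / 2

theorem angularWeight_mul_deriv_mul_cos_sub (φ : ℝ) :
    angularWeight p φ * deriv (angularWeight p) φ * Real.cos φ - angularWeight p φ ^ 2 * Real.sin φ
      = -(|Real.sin φ| ^ (p - 1) * Real.sin φ) := by
  have h := sub_mul_deriv_dslope_rpow (m := (p + 1) / 2) (by linarith) (Real.sin φ ^ 2)
  rw [show (p + 1) / 2 - 1 = (p - 1) / 2 by ring, sq_rpow_half] at h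
  have hp1 : 2 / (p + 1) * ((p + 1) / 2) = 1 := by field_simp
  rw [angularWeight_mul_deriv hp, angularWeight_sq hp, angularWeightSq]
  linear_combination -Real.sin φ * (2 / (p + 1)) * h
    + (2 / (p + 1)) * deriv (dslope (fun v : ℝ => v ^ ((p + 1) / 2)) 1) (Real.sin φ ^ 2)
      * Real.sin φ * Real.cos_sq' φ - Real.sin φ * |Real.sin φ| ^ (p - 1) * hp1

end AngularWeight

section Oscillator

/-- The angular velocity of the oscillator in the polar angle `φ` given by `w = R sin φ`: for
`z = (R^((p-1)/2), R^((q-p)/2))` and `k = (j_p φ, j_q φ)` conservation of energy reads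
`φ'² = 1 + R^(p-1) j_p(φ)² + R^(q-1) j_q(φ)²`. -/
def speed (z k : ℝ × ℝ) : ℝ := √(1 + z.1 ^ 2 * (k.1 ^ 2 + z.2 ^ 2 * k.2 ^ 2))

theorem speed_arg_pos (z k : ℝ × ℝ) : 0 < 1 + z.1 ^ 2 * (k.1 ^ 2 + z.2 ^ 2 * k.2 ^ 2) := by
  positivity

theorem speed_pos (z k : ℝ × ℝ) : 0 < speed z k := Real.sqrt_pos.2 (speed_arg_pos z k)

theorem speed_sq (z k : ℝ × ℝ) : speed z k ^ 2 = 1 + z.1 ^ 2 * (k.1 ^ 2 + z.2 ^ 2 * k.2 ^ 2) :=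
  Real.sq_sqrt (speed_arg_pos z k).le

theorem contDiff_speed {n : WithTop ℕ∞} :
    ContDiff ℝ n fun w : (ℝ × ℝ) × (ℝ × ℝ) => speed w.1 w.2 :=
  ContDiff.sqrt (by fun_prop) fun w => (speed_arg_pos w.1 w.2).ne'

theorem contDiff_inv_speed {n : WithTop ℕ∞} :
    ContDiff ℝ n fun w : (ℝ × ℝ) × (ℝ × ℝ) => (speed w.1 w.2)⁻¹ :=
  contDiff_speed.inv fun w => (speed_pos w.1 w.2).ne'

/-- The pair of angular weights of the two nonlinearities. -/
def weights (p q φ : ℝ) : ℝ × ℝ := (angularWeight p φ, angularWeight q φ)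

theorem weights_periodic (p q : ℝ) : Function.Periodic (weights p q) (2 * Real.pi) := fun φ => by
  simp only [weights, angularWeight_periodic _ φ]

/-- The time in which the polar angle of the oscillator moves from `0` to `θ`. -/
def travel (p q : ℝ) (z : ℝ × ℝ) (θ : ℝ) : ℝ :=
  ∫ φ in (0 : ℝ)..θ, (speed z (weights p q φ))⁻¹

/-- The polar angle of the oscillator at time `s`, the inverse function of `travel`. -/
def phase (p q : ℝ) (z : ℝ × ℝ) (s : ℝ) : ℝ := Function.invFun (travel p q z) s

theorem travel_zero (p q : ℝ) (z : ℝ × ℝ) : travel p q z 0 = 0 :=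
  intervalIntegral.integral_same

variable {p q : ℝ} (hp : 1 < p) (hq : 1 < q)
include hp hq

theorem contDiff_weights : ContDiff ℝ 1 (weights p q) :=
  (contDiff_angularWeight hp).prodMk (contDiff_angularWeight hq)

theorem contDiff_travel : ContDiff ℝ 2 fun w : (ℝ × ℝ) × ℝ => travel p q w.1 w.2 :=
  contDiff_two_primitive contDiff_inv_speed (contDiff_weights hp hq) 0

theorem continuous_comp_weights {g : (ℝ × ℝ) × (ℝ × ℝ) → ℝ} (hg : Continuous g) (z : ℝ × ℝ) :
    Continuous fun φ => g (z, weights p q φ) :=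
  hg.comp (continuous_const.prodMk (contDiff_weights hp hq).continuous)

theorem continuous_inv_speed_weights (z : ℝ × ℝ) :
    Continuous fun φ => (speed z (weights p q φ))⁻¹ :=
  continuous_comp_weights hp hq (contDiff_inv_speed (n := 0)).continuous z

theorem hasDerivAt_travel (z : ℝ × ℝ) (θ : ℝ) :
    HasDerivAt (travel p q z) (speed z (weights p q θ))⁻¹ θ :=
  (continuous_inv_speed_weights hp hq z).integral_hasStrictDerivAt 0 θ |>.hasDerivAt

theorem travel_strictMono (z : ℝ × ℝ) : StrictMono (travel p q z) :=
  strictMono_of_hasDerivAt_pos (hasDerivAt_travel hp hq z) fun _ => inv_pos.2 (speed_pos _ _)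

theorem travel_two_pi_pos (z : ℝ × ℝ) : 0 < travel p q z (2 * Real.pi) := by
  rw [← travel_zero p q z]
  exact travel_strictMono hp hq z Real.two_pi_pos

omit hp hq in
theorem periodic_inv_speed_weights (z : ℝ × ℝ) :
    Function.Periodic (fun φ => (speed z (weights p q φ))⁻¹) (2 * Real.pi) := fun φ => by
  simp only [weights_periodic p q φ]

theorem travel_add_two_pi (z : ℝ × ℝ) (θ : ℝ) :
    travel p q z (θ + 2 * Real.pi) = travel p q z θ + travel p q z (2 * Real.pi) := by
  have h := (periodic_inv_speed_weights (p := p) (q := q) z).intervalIntegral_add_eq_add 0 θ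
    fun a b => (continuous_inv_speed_weights hp hq z).intervalIntegrable a b
  simpa only [zero_add, travel] using h

theorem travel_surjective (z : ℝ × ℝ) : Function.Surjective (travel p q z) := by
  have hint := (continuous_inv_speed_weights hp hq z).intervalIntegrable
    (μ := MeasureTheory.volume) 0 (2 * Real.pi)
  have hper := periodic_inv_speed_weights (p := p) (q := q) z
  have hpos : ∀ φ, 0 < (speed z (weights p q φ))⁻¹ := fun _ => inv_pos.2 (speed_pos _ _)
  exact Continuous.surjective
    (continuous_iff_continuousAt.2 fun θ => (hasDerivAt_travel hp hq z θ).continuousAt)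
    (hper.tendsto_atTop_intervalIntegral_of_pos' hint hpos Real.two_pi_pos)
    (hper.tendsto_atBot_intervalIntegral_of_pos' hint hpos Real.two_pi_pos)

theorem phase_travel (z : ℝ × ℝ) (θ : ℝ) : phase p q z (travel p q z θ) = θ :=
  Function.leftInverse_invFun (travel_strictMono hp hq z).injective θ

theorem travel_phase (z : ℝ × ℝ) (s : ℝ) : travel p q z (phase p q z s) = s :=
  Function.rightInverse_invFun (travel_surjective hp hq z) s

theorem contDiff_phase : ContDiff ℝ 2 fun w : (ℝ × ℝ) × ℝ => phase p q w.1 w.2 := by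
  refine contDiff_iff_contDiffAt.2 fun w => ?_
  have hf : ContDiff ℝ 2 fun v : ((ℝ × ℝ) × ℝ) × ℝ => travel p q v.1.1 v.2 - v.1.2 :=
    ((contDiff_travel hp hq).comp
      ((contDiff_fst.comp contDiff_fst).prodMk contDiff_snd)).sub (by fun_prop)
  refine contDiffAt_of_implicit_eq (u := (w, phase p q w.1 w.2)) hf.contDiffAt two_ne_zero ?_
    (.of_forall fun v hv => ?_)
  · have hpath : HasDerivAt (fun θ => (w, θ)) ((0, 1) : ((ℝ × ℝ) × ℝ) × ℝ) (phase p q w.1 w.2) :=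
      (hasDerivAt_const _ w).prodMk (hasDerivAt_id _)
    have h := ((hf.differentiable two_ne_zero (w, phase p q w.1 w.2)).hasFDerivAt.comp_hasDerivAt
      (phase p q w.1 w.2) hpath).unique ((hasDerivAt_travel hp hq w.1 _).sub_const w.2)
    rw [h]
    exact (inv_pos.2 (speed_pos _ _)).ne'
  · have hv' : travel p q v.1.1 v.2 = v.1.2 := by
      simpa only [travel_phase hp hq, sub_self, sub_eq_zero] using hv
    rw [← hv', phase_travel hp hq]

theorem hasDerivAt_phase (z : ℝ × ℝ) (s : ℝ) :
    HasDerivAt (phase p q z) (speed z (weights p q (phase p q z s))) s := by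
  have hcont : Continuous (phase p q z) :=
    (contDiff_phase hp hq).continuous.comp (Continuous.prodMk_right z)
  simpa only [inv_inv] using (hasDerivAt_travel hp hq z (phase p q z s)).of_local_left_inverse
    hcont.continuousAt (inv_pos.2 (speed_pos _ _)).ne' (.of_forall (travel_phase hp hq z))

theorem phase_add_period (z : ℝ × ℝ) (s : ℝ) :
    phase p q z (s + travel p q z (2 * Real.pi)) = phase p q z s + 2 * Real.pi := by
  apply (travel_strictMono hp hq z).injective
  rw [travel_phase hp hq, travel_add_two_pi hp hq, travel_phase hp hq]

end Oscillator

section Wave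

/-- The parameters `(R^((p-1)/2), R^((q-p)/2))` of the orbit of amplitude `R`, in which the
oscillator is smooth up to and including `R = 0`. -/
def powers (p q R : ℝ) : ℝ × ℝ := (R ^ ((p - 1) / 2), R ^ ((q - p) / 2))

/-- The solution of `w'' + w + |w|^(p-1) w + |w|^(q-1) w = 0` with amplitude `R` and `w(0) = 0`. -/
def wave (p q R s : ℝ) : ℝ := R * Real.sin (phase p q (powers p q R) s)

theorem rpow_half_sq {x : ℝ} (hx : 0 ≤ x) (m : ℝ) : (x ^ (m / 2)) ^ 2 = x ^ m := by
  rw [← Real.rpow_natCast, ← Real.rpow_mul hx]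
  congr 1
  push_cast
  ring

variable {p q R : ℝ}

theorem powers_fst_sq (hR : 0 ≤ R) : (powers p q R).1 ^ 2 = R ^ (p - 1) := rpow_half_sq hR _

theorem powers_fst_sq_mul_snd_sq (hR : 0 < R) :
    (powers p q R).1 ^ 2 * (powers p q R).2 ^ 2 = R ^ (q - 1) := by
  rw [powers, rpow_half_sq hR.le, rpow_half_sq hR.le, ← Real.rpow_add hR]
  congr 1
  ring

theorem abs_wave_le (hR : 0 ≤ R) (s : ℝ) : |wave p q R s| ≤ R := by
  rw [wave, abs_mul, abs_of_nonneg hR]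
  exact mul_le_of_le_one_right hR (Real.abs_sin_le_one _)

variable (hp : 1 < p) (hq : 1 < q)
include hp hq

theorem hasDerivAt_wave (R s : ℝ) :
    HasDerivAt (wave p q R) (R * (Real.cos (phase p q (powers p q R) s)
      * speed (powers p q R) (weights p q (phase p q (powers p q R) s)))) s :=
  ((Real.hasDerivAt_sin _).comp s (hasDerivAt_phase hp hq (powers p q R) s)).const_mul R

theorem hasDerivAt_speed_weights (z : ℝ × ℝ) (θ : ℝ) :
    HasDerivAt (fun θ => speed z (weights p q θ))
      (z.1 ^ 2 * (angularWeight p θ * deriv (angularWeight p) θ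
        + z.2 ^ 2 * (angularWeight q θ * deriv (angularWeight q) θ)) / speed z (weights p q θ))
      θ := by
  have hjp := ((contDiff_angularWeight hp).differentiable one_ne_zero θ).hasDerivAt
  have hjq := ((contDiff_angularWeight hq).differentiable one_ne_zero θ).hasDerivAt
  have h := ((((hjp.pow 2).add ((hjq.pow 2).const_mul (z.2 ^ 2))).const_mul (z.1 ^ 2)).const_add
    1).sqrt (speed_arg_pos z (weights p q θ)).ne'
  refine h.congr_deriv ?_
  have hspeed : √(1 + z.1 ^ 2 * (angularWeight p θ ^ 2 + z.2 ^ 2 * angularWeight q θ ^ 2))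
    = speed z (weights p q θ) := rfl
  simp only [Pi.add_apply, Pi.pow_apply, hspeed]
  have := (speed_pos z (weights p q θ)).ne'
  field_simp
  ring

theorem hasDerivAt_deriv_wave (hR : 0 < R) (s : ℝ) :
    HasDerivAt (deriv (wave p q R)) (-(wave p q R s + |wave p q R s| ^ (p - 1) * wave p q R s
        + |wave p q R s| ^ (q - 1) * wave p q R s)) s := by
  rw [funext fun s => (hasDerivAt_wave hp hq R s).deriv]
  set z := powers p q R with hz
  set θ := phase p q z s with hθ
  have hphase := hasDerivAt_phase hp hq z s
  refine ((((Real.hasDerivAt_cos θ).comp s hphase).mul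
    ((hasDerivAt_speed_weights hp hq z θ).comp s hphase)).const_mul R).congr_deriv ?_
  have hpowp : |R * Real.sin θ| ^ (p - 1) = z.1 ^ 2 * |Real.sin θ| ^ (p - 1) := by
    rw [abs_mul, abs_of_pos hR, Real.mul_rpow hR.le (abs_nonneg _), hz, powers_fst_sq hR.le]
  have hpowq : |R * Real.sin θ| ^ (q - 1) = z.1 ^ 2 * z.2 ^ 2 * |Real.sin θ| ^ (q - 1) := by
    rw [abs_mul, abs_of_pos hR, Real.mul_rpow hR.le (abs_nonneg _), hz,
      powers_fst_sq_mul_snd_sq hR]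
  rw [show wave p q R s = R * Real.sin θ from rfl, hpowp, hpowq]
  simp only [Function.comp_apply, ← hθ, div_mul_cancel₀ _ (speed_pos z (weights p q θ)).ne']
  have hsq := speed_sq z (weights p q θ)
  simp only [weights] at hsq ⊢
  linear_combination (-R * Real.sin θ) * hsq
    + R * z.1 ^ 2 * angularWeight_mul_deriv_mul_cos_sub hp θ
    + R * z.1 ^ 2 * z.2 ^ 2 * angularWeight_mul_deriv_mul_cos_sub hq θ

theorem exists_wave_eq (R : ℝ) {a : ℝ} (ha : a ∈ Set.Icc (-1 : ℝ) 1) :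
    ∃ s, wave p q R s = R * a :=
  ⟨travel p q (powers p q R) (Real.arcsin a), by
    rw [wave, phase_travel hp hq, Real.sin_arcsin ha.1 ha.2]⟩

end Wave

section Period

/-- The period of the oscillation of amplitude `R`. -/
def period (p q R : ℝ) : ℝ := travel p q (powers p q R) (2 * Real.pi)

/-- The integrand of `defect`. -/
def defectDensity (w : (ℝ × ℝ) × (ℝ × ℝ)) : ℝ :=
  (w.2.1 ^ 2 + w.1.2 ^ 2 * w.2.2 ^ 2) / (speed w.1 w.2 * (1 + speed w.1 w.2))

/-- The quotient `(2π - period R) / R^(p-1)` as a smooth function of `z = powers p q R`. -/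
def defect (p q : ℝ) (z : ℝ × ℝ) : ℝ :=
  ∫ φ in (0 : ℝ)..(2 * Real.pi), defectDensity (z, weights p q φ)

/-- The integrand of `rate`. -/
def rateDensity (p q : ℝ) (w : (ℝ × ℝ) × (ℝ × ℝ)) : ℝ :=
  ((p - 1) * w.2.1 ^ 2 + (q - 1) * (w.1.2 ^ 2 * w.2.2 ^ 2)) / (2 * speed w.1 w.2 ^ 3)

/-- The quotient `-period'(R) / R^(p-2)` as a smooth function of `z = powers p q R`. -/
def rate (p q : ℝ) (z : ℝ × ℝ) : ℝ :=
  ∫ φ in (0 : ℝ)..(2 * Real.pi), rateDensity p q (z, weights p q φ)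

theorem contDiff_defectDensity : ContDiff ℝ 2 defectDensity := by
  have := contDiff_speed (n := 2)
  refine ContDiff.div (by fun_prop) (by fun_prop) fun w => ?_
  have := speed_pos w.1 w.2
  positivity

theorem contDiff_rateDensity (p q : ℝ) : ContDiff ℝ 2 (rateDensity p q) := by
  have := contDiff_speed (n := 2)
  refine ContDiff.div (by fun_prop) (by fun_prop) fun w => ?_
  have := speed_pos w.1 w.2
  positivity

theorem one_sub_inv_speed (z k : ℝ × ℝ) :
    1 - (speed z k)⁻¹ = z.1 ^ 2 * defectDensity (z, k) := by
  have hspeed := speed_pos z k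
  have hone : 1 + speed z k ≠ 0 := by positivity
  rw [defectDensity]
  field_simp
  linear_combination speed_sq z k

theorem inv_speed_le {z k : ℝ × ℝ} (hz : 0 < z.1) (hk : 0 < k.1) :
    (speed z k)⁻¹ ≤ z.1⁻¹ * k.1⁻¹ := by
  rw [← mul_inv]
  refine inv_anti₀ (mul_pos hz hk) (Real.le_sqrt_of_sq_le ?_)
  nlinarith [sq_nonneg (z.1 * (z.2 * k.2))]

variable {p q R : ℝ}

theorem hasDerivAt_powers (hR : 0 < R) :
    HasDerivAt (powers p q) ((p - 1) / 2 * (powers p q R).1 / R,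
      (q - p) / 2 * (powers p q R).2 / R) R := by
  have h : ∀ a : ℝ, HasDerivAt (fun R : ℝ => R ^ a) (a * R ^ a / R) R := fun a => by
    refine (Real.hasDerivAt_rpow_const (Or.inl hR.ne')).congr_deriv ?_
    rw [Real.rpow_sub_one hR.ne', mul_div_assoc]
  exact (h _).prodMk (h _)

theorem contDiffAt_powers {n : WithTop ℕ∞} (hR : 0 < R) : ContDiffAt ℝ n (powers p q) R :=
  (Real.contDiffAt_rpow_const_of_ne hR.ne').prodMk (Real.contDiffAt_rpow_const_of_ne hR.ne')

theorem hasDerivAt_inv_speed_powers (hR : 0 < R) (k : ℝ × ℝ) :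
    HasDerivAt (fun R => (speed (powers p q R) k)⁻¹)
      (-(R ^ (p - 1) / R * rateDensity p q (powers p q R, k))) R := by
  set z := powers p q R with hz
  have hpowers := hasDerivAt_powers (p := p) (q := q) hR
  rw [← hz] at hpowers
  have h₁ : HasDerivAt (fun R => (powers p q R).1) ((p - 1) / 2 * z.1 / R) R := hpowers.fst
  have h₂ : HasDerivAt (fun R => (powers p q R).2) ((q - p) / 2 * z.2 / R) R := hpowers.snd
  have h := ((((h₁.pow 2).mul (((h₂.pow 2).mul_const (k.2 ^ 2)).const_add (k.1 ^ 2))).const_add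
    1).sqrt (speed_arg_pos z k).ne').inv (speed_pos z k).ne'
  refine h.congr_deriv ?_
  have hspeed : √(1 + z.1 ^ 2 * (k.1 ^ 2 + z.2 ^ 2 * k.2 ^ 2)) = speed z k := rfl
  simp only [Pi.mul_apply, Pi.pow_apply, ← hz, hspeed]
  rw [← powers_fst_sq (q := q) hR.le, ← hz, rateDensity]
  have := (speed_pos z k).ne'
  field_simp
  ring

variable (hp : 1 < p) (hpq : p < q)
include hp hpq

theorem continuous_powers : Continuous (powers p q) :=
  (Real.continuous_rpow_const (by linarith)).prodMk (Real.continuous_rpow_const (by linarith))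

theorem powers_zero : powers p q 0 = 0 := by
  rw [powers, Real.zero_rpow (by linarith), Real.zero_rpow (by linarith)]
  rfl

theorem contDiff_integral_weights {g : (ℝ × ℝ) × (ℝ × ℝ) → ℝ} (hg : ContDiff ℝ 2 g) :
    ContDiff ℝ 2 fun z : ℝ × ℝ => ∫ φ in (0 : ℝ)..(2 * Real.pi), g (z, weights p q φ) :=
  (contDiff_two_primitive hg (contDiff_weights hp (hp.trans hpq)) 0).comp
    (contDiff_id.prodMk (contDiff_const (c := 2 * Real.pi)))

theorem contDiff_defect : ContDiff ℝ 2 (defect p q) :=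
  contDiff_integral_weights hp hpq contDiff_defectDensity

theorem contDiff_rate : ContDiff ℝ 2 (rate p q) :=
  contDiff_integral_weights hp hpq (contDiff_rateDensity p q)

theorem defect_pos (z : ℝ × ℝ) : 0 < defect p q z := by
  refine intervalIntegral.intervalIntegral_pos_of_pos
    ((continuous_comp_weights hp (hp.trans hpq)
      contDiff_defectDensity.continuous z).intervalIntegrable _ _) (fun φ => ?_) Real.two_pi_pos
  have hspeed := speed_pos z (weights p q φ)
  have hweight : 0 < (weights p q φ).1 := Real.sqrt_pos.2 (angularWeightSq_pos hp φ)
  simp only [defectDensity]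
  positivity

theorem rate_pos (z : ℝ × ℝ) : 0 < rate p q z := by
  refine intervalIntegral.intervalIntegral_pos_of_pos
    ((continuous_comp_weights hp (hp.trans hpq)
      (contDiff_rateDensity p q).continuous z).intervalIntegrable _ _) (fun φ => ?_)
    Real.two_pi_pos
  have hspeed := speed_pos z (weights p q φ)
  have hweight : 0 < (weights p q φ).1 := Real.sqrt_pos.2 (angularWeightSq_pos hp φ)
  have : 0 < p - 1 := by linarith
  have : 0 < q - 1 := by linarith
  simp only [rateDensity]
  positivity

theorem two_pi_sub_period (hR : 0 ≤ R) :
    2 * Real.pi - period p q R = R ^ (p - 1) * defect p q (powers p q R) := by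
  have hint := continuous_inv_speed_weights hp (hp.trans hpq) (powers p q R)
  rw [defect, ← powers_fst_sq (q := q) hR, ← intervalIntegral.integral_const_mul]
  simp only [← one_sub_inv_speed]
  rw [intervalIntegral.integral_sub intervalIntegrable_const (hint.intervalIntegrable _ _)]
  simp [period, travel]

theorem period_zero : period p q 0 = 2 * Real.pi := by
  have := two_pi_sub_period hp hpq le_rfl
  rw [Real.zero_rpow (by linarith), zero_mul] at this
  linarith

theorem continuous_period : Continuous (period p q) :=
  (contDiff_travel hp (hp.trans hpq)).continuous.comp
    ((continuous_powers hp hpq).prodMk (continuous_const (y := 2 * Real.pi)))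

theorem contDiffAt_period (hR : 0 < R) : ContDiffAt ℝ 2 (period p q) R :=
  (contDiff_travel hp (hp.trans hpq)).contDiffAt.comp R
    ((contDiffAt_powers hR).prodMk (contDiffAt_const (c := 2 * Real.pi)))

theorem hasDerivAt_period (hR : 0 < R) :
    HasDerivAt (period p q) (-(R ^ (p - 1) / R * rate p q (powers p q R))) R := by
  refine (hasDerivAt_intervalIntegral_comp (g := fun w => (speed w.1 w.2)⁻¹) contDiff_inv_speed
    (contDiff_weights hp (hp.trans hpq)).continuous (hasDerivAt_powers hR)
    (fun φ => hasDerivAt_inv_speed_powers hR (weights p q φ)) 0 (2 * Real.pi)).congr_deriv ?_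
  rw [intervalIntegral.integral_neg, intervalIntegral.integral_const_mul, rate]

theorem period_deriv_neg (hR : 0 < R) : -(R ^ (p - 1) / R * rate p q (powers p q R)) < 0 := by
  have := rate_pos hp hpq (powers p q R)
  have := Real.rpow_pos_of_pos hR (p - 1)
  rw [neg_lt_zero]
  positivity

theorem period_strictAntiOn : StrictAntiOn (period p q) (Set.Ici 0) := by
  refine strictAntiOn_of_deriv_neg (convex_Ici 0) (continuous_period hp hpq).continuousOn ?_
  intro R hR
  rw [interior_Ici, Set.mem_Ioi] at hR
  rw [(hasDerivAt_period hp hpq hR).deriv]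
  exact period_deriv_neg hp hpq hR

theorem period_pos (R : ℝ) : 0 < period p q R := travel_two_pi_pos hp (hp.trans hpq) _

theorem tendsto_period_atTop : Filter.Tendsto (period p q) Filter.atTop (𝓝 0) := by
  have hweight : ∀ φ, 0 < angularWeight p φ := fun φ =>
    Real.sqrt_pos.2 (angularWeightSq_pos hp φ)
  set C := ∫ φ in (0 : ℝ)..(2 * Real.pi), (angularWeight p φ)⁻¹ with hC
  have hlim : Filter.Tendsto (fun R : ℝ => (R ^ ((p - 1) / 2))⁻¹ * C) Filter.atTop (𝓝 0) := by
    simpa using ((tendsto_rpow_atTop (by linarith : 0 < (p - 1) / 2)).inv_tendsto_atTop).mul_const C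
  refine tendsto_of_tendsto_of_tendsto_of_le_of_le' tendsto_const_nhds hlim
    (.of_forall fun R => (period_pos hp hpq R).le) ?_
  filter_upwards [Filter.eventually_gt_atTop 0] with R hR
  rw [hC, ← intervalIntegral.integral_const_mul]
  exact intervalIntegral.integral_mono_on Real.two_pi_pos.le
    ((continuous_inv_speed_weights hp (hp.trans hpq) _).intervalIntegrable _ _)
    ((continuous_const.mul ((contDiff_angularWeight hp).continuous.inv₀
      fun φ => (hweight φ).ne')).intervalIntegrable _ _)
    fun φ _ => inv_speed_le (Real.rpow_pos_of_pos hR _) (hweight φ)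

theorem exists_period_eq {v : ℝ} (hv : 0 < v) (hv1 : v ≤ 1) :
    ∃ R ∈ Set.Ici (0 : ℝ), period p q R = 2 * Real.pi * v := by
  have hpos : 0 < 2 * Real.pi * v := mul_pos Real.two_pi_pos hv
  obtain ⟨S, hS, hS0⟩ := (((tendsto_period_atTop hp hpq).eventually
    (gt_mem_nhds hpos)).and (Filter.eventually_ge_atTop 0)).exists
  obtain ⟨R, hR, hR'⟩ := intermediate_value_Icc' hS0 (continuous_period hp hpq).continuousOn
    (show 2 * Real.pi * v ∈ Set.Icc (period p q S) (period p q 0) from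
      ⟨hS.le, by rw [period_zero hp hpq]; nlinarith [Real.two_pi_pos]⟩)
  exact ⟨R, hR.1, hR'⟩

end Period

section Amplitude

/-- The amplitude of the oscillation of period `2πv`; meaningful for `0 < v ≤ 1`. -/
def amplitude (p q v : ℝ) : ℝ := Function.invFunOn (period p q) (Set.Ici 0) (2 * Real.pi * v)

variable {p q : ℝ} (hp : 1 < p) (hpq : p < q) {v : ℝ}
include hp hpq

theorem amplitude_nonneg (hv : 0 < v) (hv1 : v ≤ 1) : 0 ≤ amplitude p q v :=
  Function.invFunOn_mem (exists_period_eq hp hpq hv hv1)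

theorem period_amplitude (hv : 0 < v) (hv1 : v ≤ 1) :
    period p q (amplitude p q v) = 2 * Real.pi * v :=
  Function.invFunOn_eq (exists_period_eq hp hpq hv hv1)

theorem amplitude_eq_of_period_eq {R : ℝ} (hR : 0 ≤ R) (h : period p q R = 2 * Real.pi * v) :
    amplitude p q v = R := by
  rw [amplitude, ← h]
  exact (period_strictAntiOn hp hpq).injOn.leftInvOn_invFunOn hR

theorem amplitude_one : amplitude p q 1 = 0 :=
  amplitude_eq_of_period_eq hp hpq le_rfl (by rw [period_zero hp hpq, mul_one])

theorem amplitude_lt_iff {R : ℝ} (hv : 0 < v) (hv1 : v ≤ 1) (hR : 0 ≤ R) :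
    amplitude p q v < R ↔ period p q R < 2 * Real.pi * v := by
  rw [← period_amplitude hp hpq hv hv1]
  exact ((period_strictAntiOn hp hpq).lt_iff_gt hR (amplitude_nonneg hp hpq hv hv1)).symm

theorem amplitude_strictAntiOn : StrictAntiOn (amplitude p q) (Set.Ioc 0 1) :=
  fun v hv w hw hvw => by
    rw [amplitude_lt_iff hp hpq hw.1 hw.2 (amplitude_nonneg hp hpq hv.1 hv.2),
      period_amplitude hp hpq hv.1 hv.2]
    exact mul_lt_mul_of_pos_left hvw Real.two_pi_pos

theorem amplitude_pos (hv : 0 < v) (hv1 : v < 1) : 0 < amplitude p q v := by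
  rw [← amplitude_one hp hpq]
  exact amplitude_strictAntiOn hp hpq ⟨hv, hv1.le⟩ ⟨one_pos, le_rfl⟩ hv1

theorem two_pi_mul_one_sub (hv : 0 < v) (hv1 : v ≤ 1) :
    2 * Real.pi * (1 - v)
      = amplitude p q v ^ (p - 1) * defect p q (powers p q (amplitude p q v)) := by
  rw [← two_pi_sub_period hp hpq (amplitude_nonneg hp hpq hv hv1),
    period_amplitude hp hpq hv hv1]
  ring

theorem contDiffAt_amplitude (hv : 0 < v) (hv1 : v < 1) :
    ContDiffAt ℝ 2 (amplitude p q) v := by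
  have hR := amplitude_pos hp hpq hv hv1
  have hf : ContDiffAt ℝ 2 (fun w : ℝ × ℝ => period p q w.2 - 2 * Real.pi * w.1)
      (v, amplitude p q v) :=
    ((contDiffAt_period hp hpq hR).comp (v, amplitude p q v) contDiffAt_snd).sub (by fun_prop)
  refine contDiffAt_of_implicit_eq hf two_ne_zero ?_ ?_
  · have hpath : HasDerivAt (fun R => (v, R)) ((0, 1) : ℝ × ℝ) (amplitude p q v) :=
      (hasDerivAt_const _ v).prodMk (hasDerivAt_id _)
    have h := ((hf.differentiableAt two_ne_zero).hasFDerivAt.comp_hasDerivAt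
      (amplitude p q v) hpath).unique ((hasDerivAt_period hp hpq hR).sub_const (2 * Real.pi * v))
    rw [h]
    exact (period_deriv_neg hp hpq hR).ne
  · filter_upwards [continuousAt_snd.eventually_mem (lt_mem_nhds hR)] with w hw hwf
    refine amplitude_eq_of_period_eq hp hpq (le_of_lt hw) ?_
    simpa only [period_amplitude hp hpq hv hv1.le, sub_self, sub_eq_zero] using hwf

theorem hasDerivAt_amplitude (hv : 0 < v) (hv1 : v < 1) :
    HasDerivAt (amplitude p q) (-(2 * Real.pi) / (amplitude p q v ^ (p - 1) / amplitude p q v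
      * rate p q (powers p q (amplitude p q v)))) v := by
  have hR := amplitude_pos hp hpq hv hv1
  have hrate := rate_pos hp hpq (powers p q (amplitude p q v))
  have := Real.rpow_pos_of_pos hR (p - 1)
  have hd : HasDerivAt (amplitude p q) (deriv (amplitude p q) v) v :=
    ((contDiffAt_amplitude hp hpq hv hv1).differentiableAt two_ne_zero).hasDerivAt
  have hcomp := (hasDerivAt_period hp hpq hR).comp v hd
  have hlin : HasDerivAt (fun v => 2 * Real.pi * v) (2 * Real.pi * 1) v :=
    (hasDerivAt_id v).const_mul _
  have heq : period p q ∘ amplitude p q =ᶠ[𝓝 v] fun v => 2 * Real.pi * v := by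
    filter_upwards [Ioo_mem_nhds hv hv1] with w hw
    exact period_amplitude hp hpq hw.1 hw.2.le
  have huniq := hcomp.unique (hlin.congr_of_eventuallyEq heq)
  refine hd.congr_deriv ?_
  rw [eq_div_iff (by positivity)]
  linarith

end Amplitude

theorem eventually_forall_mem_ball_infDist {V : Type*} [PseudoMetricSpace V] {K : Set V}
    {P : V → Prop} {z₀ : V} (hz₀ : z₀ ∈ K)
    (hP : ∀ᶠ z in 𝓝 z₀, P z) :
    ∀ᶠ z in 𝓝 z₀, ∀ w ∈ Metric.ball z (Metric.infDist z K), P w := by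
  obtain ⟨δ, hδ, hball⟩ := Metric.eventually_nhds_iff_ball.1 hP
  filter_upwards [Metric.ball_mem_nhds z₀ (half_pos hδ)] with z hz w hw
  refine hball w ?_
  have h₁ := dist_triangle w z z₀
  have h₂ := Metric.infDist_le_dist_of_mem hz₀ (x := z)
  rw [Metric.mem_ball] at hz hw ⊢
  linarith

theorem continuous_of_tendsto_zero {V F : Type*} [TopologicalSpace V] [TopologicalSpace F] [Zero F]
    {K : Set V} {f : V → F} (hzero : ∀ z ∈ K, f z = 0)
    (hcont : ∀ z ∉ K, ContinuousAt f z)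
    (hlim : ∀ z ∈ K, Filter.Tendsto f (𝓝[Kᶜ] z) (𝓝 0)) : Continuous f := by
  refine continuous_iff_continuousAt.2 fun z => ?_
  by_cases hz : z ∈ K
  · rw [ContinuousAt, hzero z hz, ← nhdsWithin_univ, ← Set.union_compl_self K,
      nhdsWithin_union, Filter.tendsto_sup]
    refine ⟨tendsto_const_nhds.congr' ?_, hlim z hz⟩
    filter_upwards [self_mem_nhdsWithin] with w hw using (hzero w hw).symm
  · exact hcont z hz

section Flat

variable {V W F : Type*} [NormedAddCommGroup V] [NormedSpace ℝ V] [NormedAddCommGroup W]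
  [NormedSpace ℝ W] [NormedAddCommGroup F] [NormedSpace ℝ F] {n : ℕ} {K : Set V} {f : V → F}

/-- A `Cⁿ` function that vanishes on `K` together with its derivatives up to order `n`. -/
structure FlatOn (n : ℕ) (K : Set V) (f : V → F) : Prop where
  contDiff : ContDiff ℝ n f
  iteratedFDeriv_eq_zero : ∀ k ≤ n, ∀ z ∈ K, iteratedFDeriv ℝ k f z = 0

theorem FlatOn.eq_zero (hf : FlatOn n K f) {z : V} (hz : z ∈ K) : f z = 0 := by
  rw [← norm_eq_zero, ← norm_iteratedFDeriv_zero (𝕜 := ℝ),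
    hf.iteratedFDeriv_eq_zero 0 n.zero_le z hz, norm_zero]

theorem FlatOn.nonneg_of_pos {f : V → ℝ} (hf : FlatOn n K f) (hpos : ∀ z ∉ K, 0 < f z) (z : V) :
    0 ≤ f z := by
  by_cases hz : z ∈ K
  · exact (hf.eq_zero hz).ge
  · exact (hpos z hz).le

theorem FlatOn.of_le (hf : FlatOn n K f) {m : ℕ} (hm : m ≤ n) : FlatOn m K f :=
  ⟨hf.contDiff.of_le (mod_cast hm), fun k hk => hf.iteratedFDeriv_eq_zero k (hk.trans hm)⟩

theorem FlatOn.differentiable (hf : FlatOn n K f) (hn : n ≠ 0) : Differentiable ℝ f :=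
  hf.contDiff.differentiable (mod_cast hn)

theorem flatOn_succ_iff_fderiv : FlatOn (n + 1) K f ↔
    Differentiable ℝ f ∧ (∀ z ∈ K, f z = 0) ∧ FlatOn n K (fderiv ℝ f) := by
  have hnorm (k : ℕ) (z : V) :
      iteratedFDeriv ℝ k (fderiv ℝ f) z = 0 ↔ iteratedFDeriv ℝ (k + 1) f z = 0 := by
    rw [← norm_eq_zero, norm_iteratedFDeriv_fderiv, norm_eq_zero]
  constructor
  · refine fun hf => ⟨hf.differentiable n.succ_ne_zero, fun z hz => hf.eq_zero hz,
      hf.contDiff.fderiv_right (by norm_cast), fun k hk z hz => ?_⟩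
    exact (hnorm k z).2 (hf.iteratedFDeriv_eq_zero (k + 1) (by omega) z hz)
  · rintro ⟨hf, hzero, hderiv⟩
    refine ⟨?_, fun k hk z hz => ?_⟩
    · push_cast
      exact contDiff_succ_iff_fderiv.2 ⟨hf, fun h => absurd h (by simp), hderiv.contDiff⟩
    · cases k with
      | zero => rw [← norm_eq_zero, norm_iteratedFDeriv_zero, hzero z hz, norm_zero]
      | succ k => exact (hnorm k z).1 (hderiv.iteratedFDeriv_eq_zero k (by omega) z hz)

theorem FlatOn.flatOn_fderiv (hf : FlatOn (n + 1) K f) : FlatOn n K (fderiv ℝ f) :=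
  (flatOn_succ_iff_fderiv.1 hf).2.2

theorem FlatOn.tendsto_iteratedFDeriv (hf : FlatOn n K f) {k : ℕ} (hk : k ≤ n) {z₀ : V}
    (hz₀ : z₀ ∈ K) : Filter.Tendsto (iteratedFDeriv ℝ k f) (𝓝 z₀) (𝓝 0) := by
  rw [← hf.iteratedFDeriv_eq_zero k hk z₀ hz₀]
  exact (hf.contDiff.continuous_iteratedFDeriv (mod_cast hk)).tendsto z₀

theorem FlatOn.tendsto (hf : FlatOn n K f) {z₀ : V} (hz₀ : z₀ ∈ K) :
    Filter.Tendsto f (𝓝 z₀) (𝓝 0) := by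
  rw [← hf.eq_zero hz₀]
  exact hf.contDiff.continuous.tendsto z₀

theorem FlatOn.add {g : V → F} (hf : FlatOn n K f) (hg : FlatOn n K g) :
    FlatOn n K (fun z => f z + g z) := by
  refine ⟨hf.contDiff.add hg.contDiff, fun k hk z hz => ?_⟩
  rw [fun_iteratedFDeriv_add_apply (hf.contDiff.contDiffAt.of_le (mod_cast hk))
      (hg.contDiff.contDiffAt.of_le (mod_cast hk)), hf.iteratedFDeriv_eq_zero k hk z hz,
    hg.iteratedFDeriv_eq_zero k hk z hz, add_zero]

theorem FlatOn.comp_continuousLinearMap (hf : FlatOn n K f) (L : W →L[ℝ] V) :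
    FlatOn n (L ⁻¹' K) (f ∘ L) := by
  refine ⟨hf.contDiff.comp L.contDiff, fun k hk z hz => ?_⟩
  rw [L.iteratedFDeriv_comp_right hf.contDiff z (mod_cast hk),
    hf.iteratedFDeriv_eq_zero k hk (L z) hz]
  rfl

section ProperSpace

variable [ProperSpace V]

/-- The bound follows the segment to a nearest point of `K`; the open ball contains the segment up
to its endpoint. -/
theorem norm_le_mul_infDist (hK : IsClosed K) (hne : K.Nonempty) (hf : Continuous f)
    (hzero : ∀ z ∈ K, f z = 0) {z : V} {C : ℝ}
    (hdiff : ∀ w ∈ Metric.ball z (Metric.infDist z K), DifferentiableAt ℝ f w)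
    (hC : ∀ w ∈ Metric.ball z (Metric.infDist z K), ‖fderiv ℝ f w‖ ≤ C) :
    ‖f z‖ ≤ C * Metric.infDist z K := by
  obtain hd | hd := Metric.infDist_nonneg.eq_or_lt' (a := Metric.infDist z K)
  · rw [hzero z ((hK.mem_iff_infDist_zero hne).2 hd), hd, norm_zero, mul_zero]
  obtain ⟨y, hyK, hy⟩ := hK.exists_infDist_eq_dist hne z
  have hball (w : V) (hw : w ∈ Metric.ball z (Metric.infDist z K)) :
      ‖f w - f z‖ ≤ C * ‖w - z‖ :=
    (convex_ball z _).norm_image_sub_le_of_norm_fderiv_le hdiff hC (Metric.mem_ball_self hd) hw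
  have hmem : y ∈ closure (Metric.ball z (Metric.infDist z K)) := by
    rw [closure_ball z hd.ne', Metric.mem_closedBall', hy]
  have hclosed : IsClosed {w | ‖f w - f z‖ ≤ C * ‖w - z‖} :=
    isClosed_le (by fun_prop) (by fun_prop)
  have h : ‖f y - f z‖ ≤ C * ‖y - z‖ := closure_minimal hball hclosed hmem
  rwa [hzero y hyK, zero_sub, norm_neg, ← dist_eq_norm, dist_comm, ← hy] at h

theorem hasFDerivAt_zero_of_tendsto (hK : IsClosed K) (hf : Continuous f)
    (hzero : ∀ z ∈ K, f z = 0) (hdiff : ∀ z ∉ K, DifferentiableAt ℝ f z) {z₀ : V} (hz₀ : z₀ ∈ K)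
    (hlim : Filter.Tendsto (fun z => ‖fderiv ℝ f z‖) (𝓝[Kᶜ] z₀) (𝓝 0)) :
    HasFDerivAt f (0 : V →L[ℝ] F) z₀ := by
  rw [hasFDerivAt_iff_isLittleO, Asymptotics.isLittleO_iff]
  intro c hc
  have hev := eventually_forall_mem_ball_infDist hz₀
    (eventually_nhdsWithin_iff.1 (hlim.eventually_le_const hc))
  filter_upwards [hev] with z hz
  have hsub : Metric.ball z (Metric.infDist z K) ⊆ Kᶜ := Metric.ball_infDist_subset_compl
  rw [hzero z₀ hz₀, sub_zero, zero_apply, sub_zero, ← dist_eq_norm]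
  calc ‖f z‖ ≤ c * Metric.infDist z K :=
        norm_le_mul_infDist hK ⟨z₀, hz₀⟩ hf hzero (fun w hw => hdiff w (hsub hw))
          fun w hw => hz w hw (hsub hw)
    _ ≤ c * dist z z₀ := by
        gcongr
        exact Metric.infDist_le_dist_of_mem hz₀

theorem flatOn_of_tendsto (hK : IsClosed K) (hzero : ∀ z ∈ K, f z = 0)
    (hdiff : ∀ z ∉ K, ContDiffAt ℝ n f z)
    (hlim : ∀ k ≤ n, ∀ z ∈ K, Filter.Tendsto (fun z => ‖iteratedFDeriv ℝ k f z‖) (𝓝[Kᶜ] z) (𝓝 0)) :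
    FlatOn n K f := by
  have hd (k : ℕ) (hk : k < n) (z : V) (hz : z ∉ K) :
      DifferentiableAt ℝ (iteratedFDeriv ℝ k f) z :=
    (hdiff z hz).differentiableAt_iteratedFDeriv (mod_cast hk)
  have hcont (k : ℕ) (hk : k ≤ n) (h0 : ∀ z ∈ K, iteratedFDeriv ℝ k f z = 0) :
      Continuous (iteratedFDeriv ℝ k f) :=
    continuous_of_tendsto_zero h0
      (fun z hz => (hdiff z hz).continuousAt_iteratedFDeriv (mod_cast hk))
      fun z hz => tendsto_zero_iff_norm_tendsto_zero.2 (hlim k hk z hz)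
  have hderiv (k : ℕ) (hk : k < n) (h0 : ∀ z ∈ K, iteratedFDeriv ℝ k f z = 0) (z : V)
      (hz : z ∈ K) : HasFDerivAt (iteratedFDeriv ℝ k f) (0 : V →L[ℝ] V [×k]→L[ℝ] F) z := by
    refine hasFDerivAt_zero_of_tendsto hK (hcont k hk.le h0) h0 (hd k hk) hz ?_
    simpa only [norm_fderiv_iteratedFDeriv] using hlim (k + 1) hk z hz
  have hvanish : ∀ k ≤ n, ∀ z ∈ K, iteratedFDeriv ℝ k f z = 0 := by
    intro k
    induction k with
    | zero =>
        intro _ z hz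
        rw [← norm_eq_zero, norm_iteratedFDeriv_zero, hzero z hz, norm_zero]
    | succ k ih =>
        intro hk z hz
        rw [← norm_eq_zero, ← norm_fderiv_iteratedFDeriv,
          (hderiv k hk (ih (Nat.le_of_succ_le hk)) z hz).fderiv]
        exact ContinuousLinearMap.opNorm_zero
  refine ⟨contDiff_nat_iff_continuous_differentiable.2
    ⟨fun k hk => hcont k hk (hvanish k hk), fun k hk z => ?_⟩, hvanish⟩
  by_cases hz : z ∈ K
  · exact (hderiv k hk (hvanish k hk.le) z hz).differentiableAt
  · exact hd k hk z hz

theorem FlatOn.eventually_norm_iteratedFDeriv_le (hK : IsClosed K) (hf : FlatOn n K f) {k m : ℕ}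
    (hkm : k + m ≤ n) {z₀ : V} (hz₀ : z₀ ∈ K) {ε : ℝ} (hε : 0 < ε) :
    ∀ᶠ z in 𝓝 z₀, ‖iteratedFDeriv ℝ k f z‖ ≤ ε * Metric.infDist z K ^ m := by
  induction m generalizing k ε with
  | zero =>
    have h := (hf.tendsto_iteratedFDeriv (k := k) hkm hz₀).norm
    rw [norm_zero] at h
    simpa only [pow_zero, mul_one] using h.eventually_le_const hε
  | succ m ih =>
    have hk : k < n := by omega
    filter_upwards [eventually_forall_mem_ball_infDist hz₀
      (ih (k := k + 1) (by omega) (show 0 < ε / 2 ^ m by positivity))] with z hz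
    have hbound : ∀ w ∈ Metric.ball z (Metric.infDist z K),
        ‖fderiv ℝ (iteratedFDeriv ℝ k f) w‖ ≤ ε * Metric.infDist z K ^ m := by
      intro w hw
      rw [norm_fderiv_iteratedFDeriv]
      have hle : Metric.infDist w K ≤ 2 * Metric.infDist z K := by
        have := Metric.infDist_le_infDist_add_dist (s := K) (x := w) (y := z)
        rw [Metric.mem_ball] at hw
        linarith
      calc ‖iteratedFDeriv ℝ (k + 1) f w‖
          ≤ ε / 2 ^ m * Metric.infDist w K ^ m := hz w hw
        _ ≤ ε / 2 ^ m * (2 * Metric.infDist z K) ^ m := by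
            gcongr
            exact Metric.infDist_nonneg
        _ = ε * Metric.infDist z K ^ m := by rw [mul_pow]; field_simp
    refine (norm_le_mul_infDist hK ⟨z₀, hz₀⟩ (hf.contDiff.continuous_iteratedFDeriv
      (mod_cast hk.le)) (hf.iteratedFDeriv_eq_zero k hk.le)
      (fun w _ => hf.contDiff.differentiable_iteratedFDeriv (mod_cast hk) w) hbound).trans_eq ?_
    rw [pow_succ, mul_assoc]

theorem flatOn_smul_of_tendsto (hK : IsClosed K) {c : V → ℝ} {X : V → F}
    (hzero : ∀ z ∈ K, c z • X z = 0) (hc : ∀ z ∉ K, ContDiffAt ℝ n c z)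
    (hX : ∀ z ∉ K, ContDiffAt ℝ n X z)
    (hlim : ∀ i j, i + j ≤ n → ∀ z ∈ K, Filter.Tendsto
      (fun z => ‖iteratedFDeriv ℝ i c z‖ * ‖iteratedFDeriv ℝ j X z‖) (𝓝[Kᶜ] z) (𝓝 0)) :
    FlatOn n K (fun z => c z • X z) := by
  refine flatOn_of_tendsto hK hzero (fun z hz => (hc z hz).smul (hX z hz)) fun k hk z₀ hz₀ => ?_
  have hsum : Filter.Tendsto (fun z => ∑ i ∈ Finset.range (k + 1), (k.choose i : ℝ) *
      ‖iteratedFDeriv ℝ i c z‖ * ‖iteratedFDeriv ℝ (k - i) X z‖) (𝓝[Kᶜ] z₀) (𝓝 0) := by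
    rw [← Finset.sum_const_zero (s := Finset.range (k + 1))]
    refine tendsto_finsetSum _ fun i hi => ?_
    rw [Finset.mem_range] at hi
    simpa only [mul_assoc, mul_zero] using
      (hlim i (k - i) (by omega) z₀ hz₀).const_mul (k.choose i : ℝ)
  refine squeeze_zero' (Filter.Eventually.of_forall fun z => norm_nonneg _) ?_ hsum
  filter_upwards [self_mem_nhdsWithin] with z hz
  have h := norm_iteratedFDerivWithin_smul_le (𝕜 := ℝ) (N := n) (s := Kᶜ) (f := c) (g := X)
    (fun w hw => (hc w hw).contDiffWithinAt)
    (fun w hw => (hX w hw).contDiffWithinAt) hK.isOpen_compl.uniqueDiffOn hz (mod_cast hk)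
  simp only [iteratedFDerivWithin_of_isOpen _ hK.isOpen_compl hz] at h
  exact h

theorem FlatOn.smul (hK : IsClosed K) (hf : FlatOn n K f) {c : V → ℝ} (hc : ContDiff ℝ n c) :
    FlatOn n K (fun z => c z • f z) := by
  refine flatOn_smul_of_tendsto hK (fun z hz => by rw [hf.eq_zero hz, smul_zero])
    (fun z _ => hc.contDiffAt) (fun z _ => hf.contDiff.contDiffAt) fun i j hij z hz => ?_
  have hci := ((hc.continuous_iteratedFDeriv (m := i) (mod_cast by omega)).tendsto z).norm
  simpa only [norm_zero, mul_zero] using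
    (hci.mul (hf.tendsto_iteratedFDeriv (k := j) (by omega) hz).norm).mono_left nhdsWithin_le_nhds

theorem FlatOn.smul_right (hK : IsClosed K) {c : V → ℝ} (hc : FlatOn n K c)
    (hf : ContDiff ℝ n f) : FlatOn n K (fun z => c z • f z) := by
  refine flatOn_smul_of_tendsto hK (fun z hz => by rw [hc.eq_zero hz, zero_smul])
    (fun z _ => hc.contDiff.contDiffAt) (fun z _ => hf.contDiffAt) fun i j hij z hz => ?_
  have hfj := ((hf.continuous_iteratedFDeriv (m := j) (mod_cast by omega)).tendsto z).norm
  simpa only [norm_zero, zero_mul] using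
    ((hc.tendsto_iteratedFDeriv (k := i) (by omega) hz).norm.mul hfj).mono_left nhdsWithin_le_nhds

end ProperSpace

end Flat

section Glaeser

variable {V : Type*} [NormedAddCommGroup V] [NormedSpace ℝ V]

/-- The test point is `z - (Df(z)v / 2η) v`, where the quadratic upper bound for `f` is smallest. -/
theorem sq_norm_fderiv_le {f : V → ℝ} {z : V} {r η : ℝ} (hη : 0 < η)
    (hf : ∀ w ∈ Metric.ball z r, DifferentiableAt ℝ f w) (hnonneg : ∀ w, 0 ≤ f w)
    (hlip : ∀ w ∈ Metric.ball z r, ‖fderiv ℝ f w - fderiv ℝ f z‖ ≤ η * ‖w - z‖)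
    (hr : ‖fderiv ℝ f z‖ < 2 * η * r) : ‖fderiv ℝ f z‖ ^ 2 ≤ 4 * η * f z := by
  suffices h : ∀ v : V, ‖v‖ = 1 → ‖fderiv ℝ f z v‖ ≤ √(4 * η * f z) by
    rw [← Real.sq_sqrt (mul_nonneg (by positivity : 0 ≤ 4 * η) (hnonneg z))]
    gcongr
    exact ContinuousLinearMap.opNorm_le_of_unit_norm (Real.sqrt_nonneg _) h
  intro v hv
  refine Real.abs_le_sqrt ?_
  set a := fderiv ℝ f z v with ha
  set s := a / (2 * η) with hs
  have habs : |s| < r := by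
    have hle : |a| ≤ ‖fderiv ℝ f z‖ := by simpa [hv] using (fderiv ℝ f z).le_opNorm v
    rw [hs, abs_div, abs_of_pos (by positivity : 0 < 2 * η), div_lt_iff₀ (by positivity)]
    linarith
  have hsub : Metric.closedBall z |s| ⊆ Metric.ball z r := Metric.closedBall_subset_ball habs
  have hmem : z - s • v ∈ Metric.closedBall z |s| := by
    rw [mem_closedBall_iff_norm, sub_sub_cancel_left, norm_neg, norm_smul, hv, mul_one,
      Real.norm_eq_abs]
  have hmv := (convex_closedBall z |s|).norm_image_sub_le_of_norm_fderiv_le' (𝕜 := ℝ)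
    (φ := fderiv ℝ f z) (C := η * |s|) (fun w hw => hf w (hsub hw))
    (fun w hw => (hlip w (hsub hw)).trans (by gcongr; exact mem_closedBall_iff_norm.1 hw))
    (Metric.mem_closedBall_self (abs_nonneg s)) hmem
  rw [sub_sub_cancel_left, norm_neg, norm_smul, hv, mul_one, map_neg, map_smul, ← ha, smul_eq_mul,
    Real.norm_eq_abs, Real.norm_eq_abs, mul_assoc, abs_mul_abs_self] at hmv
  have hlower : η * (s * s) ≤ f z := by
    have hsa : s * a = 2 * (η * (s * s)) := by rw [hs]; field_simp
    linarith [(abs_le.1 hmv).2, hnonneg (z - s • v)]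
  calc a ^ 2 = 4 * η * (η * (s * s)) := by rw [hs]; field_simp; ring
    _ ≤ 4 * η * f z := by gcongr

theorem FlatOn.tendsto_sq_norm_fderiv_div {K : Set V} {f : V → ℝ} (hf : FlatOn 2 K f)
    (hnonneg : ∀ z, 0 ≤ f z) {z₀ : V} (hz₀ : z₀ ∈ K) :
    Filter.Tendsto (fun z => ‖fderiv ℝ f z‖ ^ 2 / f z) (𝓝 z₀) (𝓝 0) := by
  refine Metric.tendsto_nhds.2 fun ε hε => ?_
  set η := ε / 8 with hη
  have hηpos : 0 < η := by positivity
  have hD : Filter.Tendsto (fun z => ‖fderiv ℝ f z‖) (𝓝 z₀) (𝓝 0) := by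
    simpa only [norm_zero] using (hf.flatOn_fderiv.tendsto hz₀).norm
  have hDD : Filter.Tendsto (fun z => ‖fderiv ℝ (fderiv ℝ f) z‖) (𝓝 z₀) (𝓝 0) := by
    simpa only [norm_zero] using (hf.flatOn_fderiv.flatOn_fderiv.tendsto hz₀).norm
  obtain ⟨δ, hδ, hball⟩ := Metric.eventually_nhds_iff_ball.1 (hDD.eventually_le_const hηpos)
  filter_upwards [Metric.ball_mem_nhds z₀ (half_pos hδ),
    hD.eventually_lt_const (show 0 < 2 * η * (δ / 2) by positivity)] with z hz hDz
  have hsub : Metric.ball z (δ / 2) ⊆ Metric.ball z₀ δ := by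
    refine Metric.ball_subset_ball' ?_
    rw [Metric.mem_ball] at hz
    linarith
  have hsq : ‖fderiv ℝ f z‖ ^ 2 ≤ 4 * η * f z :=
    sq_norm_fderiv_le hηpos (fun w _ => hf.differentiable two_ne_zero w) hnonneg
      (fun w hw => (convex_ball z (δ / 2)).norm_image_sub_le_of_norm_fderiv_le
        (fun v _ => hf.flatOn_fderiv.differentiable one_ne_zero v) (fun v hv => hball v (hsub hv))
        (Metric.mem_ball_self (half_pos hδ)) hw) hDz
  rw [dist_zero_right, Real.norm_of_nonneg (div_nonneg (sq_nonneg _) (hnonneg z))]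
  calc ‖fderiv ℝ f z‖ ^ 2 / f z ≤ 4 * η := div_le_of_le_mul₀ (hnonneg z) (by positivity) hsq
    _ < ε := by rw [hη]; linarith

end Glaeser

section Composition

variable {V F : Type*} [NormedAddCommGroup V] [NormedSpace ℝ V]
  [NormedAddCommGroup F] [NormedSpace ℝ F] {K : Set V}

theorem norm_fderiv_fderiv_comp_le {f : V → ℝ} {ψ : ℝ → ℝ} {z : V} (hψ : ContDiffAt ℝ 2 ψ (f z))
    (hf : ContDiff ℝ 2 f) : ‖fderiv ℝ (fderiv ℝ (ψ ∘ f)) z‖ ≤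
      |deriv ψ (f z)| * ‖fderiv ℝ (fderiv ℝ f) z‖
        + |deriv (deriv ψ) (f z)| * ‖fderiv ℝ f z‖ ^ 2 := by
  have hfd := hf.differentiable two_ne_zero
  have hev : fderiv ℝ (ψ ∘ f) =ᶠ[𝓝 z] fun w => deriv ψ (f w) • fderiv ℝ f w := by
    filter_upwards [hf.continuous.continuousAt.eventually (hψ.eventually (by simp))] with w hw
    exact ((hw.differentiableAt two_ne_zero).hasDerivAt.comp_hasFDerivAt w
      (hfd w).hasFDerivAt).fderiv
  have hψ' : HasDerivAt (deriv ψ) (deriv (deriv ψ) (f z)) (f z) :=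
    (((hψ.fderiv_right (m := 1) (by norm_num [one_add_one_eq_two])).clm_apply
      contDiffAt_const).differentiableAt one_ne_zero).hasDerivAt
  have hDf : HasFDerivAt (fderiv ℝ f) (fderiv ℝ (fderiv ℝ f) z) z :=
    ((hf.fderiv_right (m := 1) (by norm_num [one_add_one_eq_two])).differentiable one_ne_zero
      z).hasFDerivAt
  have hprod : HasFDerivAt (fun w => deriv ψ (f w) • fderiv ℝ f w) _ z :=
    (hψ'.comp_hasFDerivAt z (hfd z).hasFDerivAt).smul hDf
  rw [hev.fderiv_eq, hprod.fderiv]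
  refine (ContinuousLinearMap.opNorm_add_le _ _).trans_eq ?_
  rw [norm_smul, ContinuousLinearMap.norm_smulRight_apply, norm_smul, Real.norm_eq_abs,
    Real.norm_eq_abs, sq, mul_assoc]
  rfl

variable [ProperSpace V]

theorem flatOn_two_of_tendsto {f : V → F} (hK : IsClosed K) (hzero : ∀ z ∈ K, f z = 0)
    (hdiff : ∀ z ∉ K, ContDiffAt ℝ 2 f z)
    (h₀ : ∀ z ∈ K, Filter.Tendsto f (𝓝[Kᶜ] z) (𝓝 0))
    (h₁ : ∀ z ∈ K, Filter.Tendsto (fun z => ‖fderiv ℝ f z‖) (𝓝[Kᶜ] z) (𝓝 0))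
    (h₂ : ∀ z ∈ K, Filter.Tendsto (fun z => ‖fderiv ℝ (fderiv ℝ f) z‖) (𝓝[Kᶜ] z) (𝓝 0)) :
    FlatOn 2 K f := by
  refine flatOn_of_tendsto hK hzero hdiff fun k hk z hz => ?_
  interval_cases k
  · simpa only [norm_iteratedFDeriv_zero, norm_zero] using (h₀ z hz).norm
  · simpa only [norm_iteratedFDeriv_one] using h₁ z hz
  · simpa only [← norm_iteratedFDeriv_fderiv (n := 1), norm_iteratedFDeriv_one] using h₂ z hz

/-- The term `ψ''(f) ‖∇f‖²` of the second derivative is the product of `f ψ''(f)`, which is bounded,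
and `‖∇f‖² / f`, which tends to `0` because `f` is nonnegative. -/
theorem FlatOn.real_comp {f : V → ℝ} {ψ : ℝ → ℝ} {C : ℝ} (hK : IsClosed K) (hf : FlatOn 2 K f)
    (hpos : ∀ z ∉ K, 0 < f z) (hψ : ∀ z ∉ K, ContDiffAt ℝ 2 ψ (f z)) (hψ0 : ψ 0 = 0)
    (hψlim : Filter.Tendsto ψ (𝓝[>] 0) (𝓝 0)) (hψ' : ∀ᶠ u in 𝓝[>] 0, |deriv ψ u| ≤ C)
    (hψ'' : ∀ᶠ u in 𝓝[>] 0, |u * deriv (deriv ψ) u| ≤ C) : FlatOn 2 K (ψ ∘ f) := by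
  have hright {z : V} (hz : z ∈ K) : Filter.Tendsto f (𝓝[Kᶜ] z) (𝓝[>] 0) :=
    tendsto_nhdsWithin_iff.2 ⟨(hf.tendsto hz).mono_left nhdsWithin_le_nhds,
      eventually_nhdsWithin_of_forall hpos⟩
  have hD {z : V} (hz : z ∈ K) : Filter.Tendsto (fun z => ‖fderiv ℝ f z‖) (𝓝 z) (𝓝 0) := by
    simpa only [norm_zero] using (hf.flatOn_fderiv.tendsto hz).norm
  have hDD {z : V} (hz : z ∈ K) :
      Filter.Tendsto (fun z => ‖fderiv ℝ (fderiv ℝ f) z‖) (𝓝 z) (𝓝 0) := by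
    simpa only [norm_zero] using (hf.flatOn_fderiv.flatOn_fderiv.tendsto hz).norm
  refine flatOn_two_of_tendsto hK (fun z hz => by rw [Function.comp_apply, hf.eq_zero hz, hψ0])
    (fun z hz => (hψ z hz).comp z hf.contDiff.contDiffAt) (fun z hz => hψlim.comp (hright hz))
    (fun z hz => ?_) fun z hz => ?_
  · have hlim := ((hD hz).const_mul C).mono_left (nhdsWithin_le_nhds (s := Kᶜ))
    rw [mul_zero] at hlim
    refine squeeze_zero' (Filter.Eventually.of_forall fun _ => norm_nonneg _) ?_ hlim
    filter_upwards [(hright hz).eventually hψ', self_mem_nhdsWithin] with w hw hwK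
    rw [(((hψ w hwK).differentiableAt two_ne_zero).hasDerivAt.comp_hasFDerivAt w
      (hf.differentiable two_ne_zero w).hasFDerivAt).fderiv, norm_smul]
    gcongr
    exact hw
  · have hlim := (((hDD hz).const_mul C).add
      ((hf.tendsto_sq_norm_fderiv_div (hf.nonneg_of_pos hpos) hz).const_mul C)).mono_left
        (nhdsWithin_le_nhds (s := Kᶜ))
    rw [mul_zero, add_zero] at hlim
    refine squeeze_zero'
      (Filter.Eventually.of_forall fun _ => ContinuousLinearMap.opNorm_nonneg _) ?_ hlim
    filter_upwards [(hright hz).eventually hψ', (hright hz).eventually hψ'',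
      self_mem_nhdsWithin] with w hw' hw'' hwK
    have hfw : 0 < f w := hpos w hwK
    refine (norm_fderiv_fderiv_comp_le (hψ w hwK) hf.contDiff).trans ?_
    have hsplit : |deriv (deriv ψ) (f w)| * ‖fderiv ℝ f w‖ ^ 2
        = |f w * deriv (deriv ψ) (f w)| * (‖fderiv ℝ f w‖ ^ 2 / f w) := by
      rw [abs_mul, abs_of_pos hfw]
      field_simp
    rw [hsplit]
    gcongr

end Composition

section Homogeneous

variable {V P F : Type*} [NormedAddCommGroup V] [NormedSpace ℝ V]
  [NormedAddCommGroup P] [NormedSpace ℝ P] [NormedAddCommGroup F] [NormedSpace ℝ F] {K : Set V}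
  {Γ : ℝ → P} {L : P →L[ℝ] P} {R s : V → ℝ} {X : V → F} {H : P × ℝ → ℝ}

theorem hasFDerivAt_comp_curve {z : V} (hΓ : HasDerivAt Γ ((R z)⁻¹ • L (Γ (R z))) (R z))
    (hR : DifferentiableAt ℝ R z) (hs : DifferentiableAt ℝ s z)
    (hH : DifferentiableAt ℝ H (Γ (R z), s z)) :
    HasFDerivAt (fun z => H (Γ (R z), s z))
      ((fderiv ℝ H (Γ (R z), s z) (L (Γ (R z)), 0) * (R z)⁻¹) • fderiv ℝ R z
        + fderiv ℝ H (Γ (R z), s z) (0, 1) • fderiv ℝ s z) z := by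
  refine (hH.hasFDerivAt.comp z ((hΓ.hasFDerivAt.comp z hR.hasFDerivAt).prodMk
    hs.hasFDerivAt)).congr_fderiv (ContinuousLinearMap.ext fun v => ?_)
  have hsplit : (fderiv ℝ R z v • (R z)⁻¹ • L (Γ (R z)), fderiv ℝ s z v)
      = (fderiv ℝ R z v * (R z)⁻¹) • ((L (Γ (R z)), 0) : P × ℝ)
        + fderiv ℝ s z v • ((0, 1) : P × ℝ) := by
    simp [smul_smul]
  change fderiv ℝ H (Γ (R z), s z) (fderiv ℝ R z v • (R z)⁻¹ • L (Γ (R z)), fderiv ℝ s z v) = _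
  rw [hsplit, map_add, map_smul, map_smul]
  simp only [smul_eq_mul, add_apply, smul_apply]
  ring

variable [ProperSpace V] (hK : IsClosed K) (hΓ : Continuous Γ)
  (hΓ' : ∀ r, 0 < r → HasDerivAt Γ (r⁻¹ • L (Γ r)) r) (hR_pos : ∀ z ∉ K, 0 < R z)
include hK hΓ hΓ' hR_pos

theorem FlatOn.smul_comp_curve (hX : FlatOn 1 K X) (hΓdiff : ∀ r, 0 < r → ContDiffAt ℝ 1 Γ r)
    (hR : ContDiff ℝ 1 R) (hs : ContDiff ℝ 1 s) (hH : ContDiff ℝ 1 H)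
    (hlim : ∀ z ∈ K,
      Filter.Tendsto (fun z => ‖fderiv ℝ R z‖ * ‖X z‖ / R z) (𝓝[Kᶜ] z) (𝓝 0)) :
    FlatOn 1 K (fun z => H (Γ (R z), s z) • X z) := by
  have hcurve : Continuous fun z => (Γ (R z), s z) :=
    (hΓ.comp hR.continuous).prodMk hs.continuous
  have hDH := (hH.continuous_fderiv one_ne_zero).comp hcurve
  refine flatOn_smul_of_tendsto hK (fun z hz => by rw [hX.eq_zero hz, smul_zero])
    (fun z hz => hH.contDiffAt.comp z
      (((hΓdiff _ (hR_pos z hz)).comp z hR.contDiffAt).prodMk hs.contDiffAt))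
    (fun z _ => hX.contDiff.contDiffAt) fun i j hij z₀ hz₀ => ?_
  have hX₀ : Filter.Tendsto (fun z => ‖X z‖) (𝓝[Kᶜ] z₀) (𝓝 0) := by
    simpa only [norm_zero] using (hX.tendsto hz₀).norm.mono_left nhdsWithin_le_nhds
  obtain rfl | rfl : i = 0 ∨ i = 1 := by omega
  · have hc := (Continuous.tendsto (f := fun z => H (Γ (R z), s z))
      (hH.continuous.comp hcurve) z₀).norm
    have hXj := (hX.tendsto_iteratedFDeriv (k := j) (by omega) hz₀).norm
    simpa only [norm_iteratedFDeriv_zero, norm_zero, mul_zero] using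
      (hc.mul hXj).mono_left nhdsWithin_le_nhds
  · obtain rfl : j = 0 := by omega
    simp only [norm_iteratedFDeriv_one, norm_iteratedFDeriv_zero]
    have hA : Continuous fun z => ‖fderiv ℝ H (Γ (R z), s z) (L (Γ (R z)), 0)‖ :=
      (hDH.clm_apply ((L.continuous.comp (hΓ.comp hR.continuous)).prodMk continuous_const)).norm
    have hB : Continuous fun z => ‖fderiv ℝ H (Γ (R z), s z) (0, 1)‖ * ‖fderiv ℝ s z‖ :=
      (hDH.clm_apply continuous_const).norm.mul (hs.continuous_fderiv one_ne_zero).norm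
    have hbound := (((hA.tendsto z₀).mono_left nhdsWithin_le_nhds).mul (hlim z₀ hz₀)).add
      (((hB.tendsto z₀).mono_left nhdsWithin_le_nhds).mul hX₀)
    rw [mul_zero, mul_zero, add_zero] at hbound
    refine squeeze_zero' (Filter.Eventually.of_forall fun z => by positivity) ?_ hbound
    filter_upwards [self_mem_nhdsWithin] with z hz
    have hRz := hR_pos z hz
    rw [(hasFDerivAt_comp_curve (hΓ' _ hRz) (hR.differentiable one_ne_zero z)
      (hs.differentiable one_ne_zero z) (hH.differentiable one_ne_zero _)).fderiv]
    refine (mul_le_mul_of_nonneg_right (norm_add_le _ _) (norm_nonneg _)).trans_eq ?_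
    rw [norm_smul, norm_smul, norm_mul, norm_inv, Real.norm_of_nonneg hRz.le]
    ring

theorem FlatOn.comp_curve_smul_smul (hR : FlatOn 1 K R)
    (hΓdiff : ∀ r, 0 < r → ContDiffAt ℝ 1 Γ r) (hs : ContDiff ℝ 1 s) (hH : ContDiff ℝ 1 H)
    (hX : ContDiff ℝ 1 X) : FlatOn 1 K (fun z => H (Γ (R z), s z) • R z • X z) := by
  refine FlatOn.smul_comp_curve hK hΓ hΓ' hR_pos (hR.smul_right hK hX) hΓdiff hR.contDiff hs hH
    fun z hz => ?_
  have hlim := ((hR.flatOn_fderiv.tendsto hz).norm.mul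
    (hX.continuous.norm.tendsto z)).mono_left (nhdsWithin_le_nhds (s := Kᶜ))
  rw [norm_zero, zero_mul] at hlim
  refine hlim.congr' ?_
  filter_upwards [self_mem_nhdsWithin] with w hw
  have hRw := hR_pos w hw
  rw [norm_smul, Real.norm_of_nonneg hRw.le]
  field_simp

theorem FlatOn.comp_curve_smul_fderiv (hR : FlatOn 2 K R)
    (hΓdiff : ∀ r, 0 < r → ContDiffAt ℝ 1 Γ r) (hs : ContDiff ℝ 1 s) (hH : ContDiff ℝ 1 H) :
    FlatOn 1 K (fun z => H (Γ (R z), s z) • fderiv ℝ R z) := by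
  refine FlatOn.smul_comp_curve hK hΓ hΓ' hR_pos hR.flatOn_fderiv hΓdiff
    (hR.contDiff.of_le one_le_two) hs hH fun z hz => ?_
  simpa only [sq] using
    (hR.tendsto_sq_norm_fderiv_div (hR.nonneg_of_pos hR_pos) hz).mono_left nhdsWithin_le_nhds

/-- By the Euler relation `r Γ'(r) = L (Γ r)`, the derivative of `H(Γ(R), s) R` again consists of
products of the same kind, with `H` replaced by `H + DH(L ·, 0)` and `DH(0, 1)`. -/
theorem FlatOn.comp_curve_mul (hR : FlatOn 2 K R) (hΓdiff : ∀ r, 0 < r → ContDiffAt ℝ 1 Γ r)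
    (hs : ContDiff ℝ 2 s) (hH : ContDiff ℝ 2 H) :
    FlatOn 2 K (fun z => H (Γ (R z), s z) * R z) := by
  have hs₁ : ContDiff ℝ 1 s := hs.of_le one_le_two
  have hDH : ContDiff ℝ 1 (fderiv ℝ H) := hH.fderiv_right (by norm_num [one_add_one_eq_two])
  have hDs : ContDiff ℝ 1 (fderiv ℝ s) := hs.fderiv_right (by norm_num [one_add_one_eq_two])
  have hflat : FlatOn 1 K (fun z => H (Γ (R z), s z) * R z) := by
    simpa only [smul_eq_mul, mul_one] using FlatOn.comp_curve_smul_smul hK hΓ hΓ' hR_pos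
      (hR.of_le one_le_two) hΓdiff hs₁ (hH.of_le one_le_two) (contDiff_const (c := (1 : ℝ)))
  have hfst := FlatOn.comp_curve_smul_fderiv (H := fun w => H w + fderiv ℝ H w (L w.1, 0)) hK hΓ hΓ'
    hR_pos hR hΓdiff hs₁ ((hH.of_le one_le_two).add (hDH.clm_apply (by fun_prop)))
  have hsnd := FlatOn.comp_curve_smul_smul (H := fun w => fderiv ℝ H w (0, 1)) hK hΓ hΓ' hR_pos
    (hR.of_le one_le_two) hΓdiff hs₁ (hDH.clm_apply contDiff_const) hDs
  refine flatOn_succ_iff_fderiv.2 ⟨hflat.differentiable one_ne_zero, fun z => hflat.eq_zero, ?_⟩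
  convert hfst.add hsnd using 1
  funext z
  by_cases hz : z ∈ K
  · simp only [hR.eq_zero hz, hR.flatOn_fderiv.eq_zero hz, hflat.flatOn_fderiv.eq_zero hz,
      zero_smul, smul_zero, add_zero]
  · have hRz := hR_pos z hz
    have hd : HasFDerivAt (fun z => H (Γ (R z), s z) * R z) _ z :=
      (hasFDerivAt_comp_curve (hΓ' _ hRz) (hR.differentiable two_ne_zero z)
        (hs₁.differentiable one_ne_zero z) (hH.differentiable two_ne_zero _)).mul
          (hR.differentiable two_ne_zero z).hasFDerivAt
    rw [hd.fderiv]
    match_scalars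
    · field_simp
    · ring

end Homogeneous

section DegreeZero

variable {V E G F : Type*} [NormedAddCommGroup V] [NormedSpace ℝ V] [NormedAddCommGroup E]
  [NormedSpace ℝ E] [NormedAddCommGroup G] [NormedSpace ℝ G] [NormedAddCommGroup F]
  [NormedSpace ℝ F] {n : ℕ}

theorem FlatOn.smul_of_norm_le [ProperSpace V] {K : Set V} {c : V → ℝ} {X : V → F}
    (hK : IsClosed K) (hc : FlatOn n K c) (hX : ∀ z ∉ K, ContDiffAt ℝ n X z)
    (hbound : ∀ j ≤ n, ∃ C, ∀ z ∉ K, ‖iteratedFDeriv ℝ j X z‖ * Metric.infDist z K ^ j ≤ C) :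
    FlatOn n K (fun z => c z • X z) := by
  refine flatOn_smul_of_tendsto hK (fun z hz => by rw [hc.eq_zero hz, zero_smul])
    (fun z _ => hc.contDiff.contDiffAt) hX fun i j hij z₀ hz₀ => ?_
  obtain ⟨C, hC⟩ := hbound j (by omega)
  refine Metric.tendsto_nhds.2 fun ε hε => ?_
  have hη : 0 < ε / (|C| + 1) := by positivity
  filter_upwards [self_mem_nhdsWithin, nhdsWithin_le_nhds
    (hc.eventually_norm_iteratedFDeriv_le hK hij hz₀ hη)] with z hz hcz
  rw [dist_zero_right, Real.norm_of_nonneg (by positivity)]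
  calc ‖iteratedFDeriv ℝ i c z‖ * ‖iteratedFDeriv ℝ j X z‖
      ≤ ε / (|C| + 1) * Metric.infDist z K ^ j * ‖iteratedFDeriv ℝ j X z‖ := by gcongr
    _ = ε / (|C| + 1) * (‖iteratedFDeriv ℝ j X z‖ * Metric.infDist z K ^ j) := by ring
    _ ≤ ε / (|C| + 1) * |C| := by
        gcongr
        exact (hC z hz).trans (le_abs_self C)
    _ < ε := by
        rw [div_mul_eq_mul_div, div_lt_iff₀ (by positivity)]
        linarith

theorem norm_iteratedFDeriv_le_of_comp_smul_eq {f : E → F} {r : ℝ} (hr : 0 < r)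
    (hf : ∀ x, f (r • x) = f x) (k : ℕ) (x : E) :
    ‖iteratedFDeriv ℝ k f x‖ ≤ ‖iteratedFDeriv ℝ k f (r • x)‖ * r ^ k := by
  set g : E ≃L[ℝ] E := ContinuousLinearEquiv.smulLeft (Units.mk0 r hr.ne')
  have hg_norm : ‖(g : E →L[ℝ] E)‖ ≤ r := by
    refine ContinuousLinearMap.opNorm_le_bound _ hr.le fun v => (norm_smul r v).trans_le ?_
    rw [Real.norm_of_nonneg hr.le]
  have hcomp : f ∘ g = f := funext hf
  have h := g.iteratedFDerivWithin_comp_right f uniqueDiffOn_univ (Set.mem_univ (g x)) k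
  rw [hcomp, Set.preimage_univ, iteratedFDerivWithin_univ] at h
  rw [h]
  refine (ContinuousMultilinearMap.norm_compContinuousLinearMap_le _ _).trans ?_
  rw [Finset.prod_const, Finset.card_univ, Fintype.card_fin]
  have hgx : g x = r • x := rfl
  rw [hgx]
  gcongr

theorem exists_norm_iteratedFDeriv_mul_pow_le [ProperSpace E] {f : E → F}
    (hf : ∀ x ≠ 0, ContDiffAt ℝ n f x) (hhom : ∀ r : ℝ, 0 < r → ∀ x, f (r • x) = f x) {k : ℕ}
    (hk : k ≤ n) : ∃ C, ∀ x ≠ 0, ‖iteratedFDeriv ℝ k f x‖ * ‖x‖ ^ k ≤ C := by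
  have hcont : ContinuousOn (iteratedFDeriv ℝ k f) (Metric.sphere 0 1) := fun x hx =>
    ((hf x (ne_zero_of_mem_unit_sphere ⟨x, hx⟩)).continuousAt_iteratedFDeriv
      (mod_cast hk)).continuousWithinAt
  obtain ⟨C, hC⟩ := (isCompact_sphere (0 : E) 1).exists_bound_of_continuousOn hcont
  refine ⟨C, fun x hx => ?_⟩
  have hx' : 0 < ‖x‖ := norm_pos_iff.2 hx
  have hunit : ‖x‖⁻¹ • x ∈ Metric.sphere (0 : E) 1 := by
    rw [mem_sphere_zero_iff_norm, norm_smul, norm_inv, norm_norm, inv_mul_cancel₀ hx'.ne']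
  calc ‖iteratedFDeriv ℝ k f x‖ * ‖x‖ ^ k
      ≤ ‖iteratedFDeriv ℝ k f (‖x‖⁻¹ • x)‖ * ‖x‖⁻¹ ^ k * ‖x‖ ^ k := by
        gcongr
        exact norm_iteratedFDeriv_le_of_comp_smul_eq (inv_pos.2 hx')
          (hhom _ (inv_pos.2 hx')) k x
    _ = ‖iteratedFDeriv ℝ k f (‖x‖⁻¹ • x)‖ := by
        rw [mul_assoc, ← mul_pow, inv_mul_cancel₀ hx'.ne', one_pow, mul_one]
    _ ≤ C := hC _ hunit

theorem norm_iteratedFDeriv_comp_fst_le {f : E → F} (hf : ∀ x ≠ 0, ContDiffAt ℝ n f x) {k : ℕ}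
    (hk : k ≤ n) {z : E × G} (hz : z.1 ≠ 0) :
    ‖iteratedFDeriv ℝ k (fun z : E × G => f z.1) z‖ ≤ ‖iteratedFDeriv ℝ k f z.1‖ := by
  have hopen : IsOpen ({0}ᶜ : Set E) := isOpen_compl_singleton
  have hopen' : IsOpen (ContinuousLinearMap.fst ℝ E G ⁻¹' {0}ᶜ) := hopen.preimage continuous_fst
  have h := (ContinuousLinearMap.fst ℝ E G).iteratedFDerivWithin_comp_right
    (s := {0}ᶜ) (fun x hx => (hf x hx).contDiffWithinAt) hopen.uniqueDiffOn hopen'.uniqueDiffOn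
    (x := z) hz (mod_cast hk : (k : WithTop ℕ∞) ≤ n)
  rw [iteratedFDerivWithin_of_isOpen k hopen' hz, iteratedFDerivWithin_of_isOpen k hopen
    (x := ContinuousLinearMap.fst ℝ E G z) hz] at h
  change ‖iteratedFDeriv ℝ k (f ∘ ContinuousLinearMap.fst ℝ E G) z‖ ≤ _
  rw [h]
  refine (ContinuousMultilinearMap.norm_compContinuousLinearMap_le _ _).trans
    (mul_le_of_le_one_right (norm_nonneg _) ?_)
  exact Finset.prod_le_one (fun _ _ => norm_nonneg _)
    fun _ _ => ContinuousLinearMap.norm_fst_le ℝ E G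

theorem FlatOn.smul_comp_fst [ProperSpace E] [ProperSpace G] {c : E × G → ℝ} {f : E → F}
    (hc : FlatOn n (Prod.fst ⁻¹' {0}) c) (hf : ∀ x ≠ 0, ContDiffAt ℝ n f x)
    (hhom : ∀ r : ℝ, 0 < r → ∀ x, f (r • x) = f x) :
    FlatOn n (Prod.fst ⁻¹' {0}) (fun z => c z • f z.1) := by
  refine FlatOn.smul_of_norm_le (isClosed_singleton.preimage continuous_fst) hc
    (fun z hz => ContDiffAt.comp (f := Prod.fst) (g := f) z (hf z.1 hz) contDiffAt_fst)
    fun j hj => ?_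
  obtain ⟨C, hC⟩ := exists_norm_iteratedFDeriv_mul_pow_le hf hhom hj
  refine ⟨C, fun z hz => ?_⟩
  have hdist : Metric.infDist z (Prod.fst ⁻¹' {0}) ≤ ‖z.1‖ := by
    have hmem : ((0, z.2) : E × G) ∈ (Prod.fst ⁻¹' {0} : Set (E × G)) := Set.mem_singleton 0
    refine (Metric.infDist_le_dist_of_mem hmem).trans_eq ?_
    rw [Prod.dist_eq, dist_self, dist_zero_right, max_eq_left (norm_nonneg _)]
  have hnonneg : 0 ≤ Metric.infDist z (Prod.fst ⁻¹' {0}) := Metric.infDist_nonneg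
  calc ‖iteratedFDeriv ℝ j (fun z : E × G => f z.1) z‖ * Metric.infDist z (Prod.fst ⁻¹' {0}) ^ j
      ≤ ‖iteratedFDeriv ℝ j f z.1‖ * ‖z.1‖ ^ j := by
        gcongr
        exact norm_iteratedFDeriv_comp_fst_le hf hj hz
    _ ≤ C := hC z.1 hz

end DegreeZero

section RadialDirection

variable {E : Type*} [NormedAddCommGroup E] [InnerProductSpace ℝ E]

/-- The radial unit vector `x / ‖x‖`, with value `0` at the origin. -/
def radialUnit (x : E) : E := ‖x‖⁻¹ • x

theorem contDiffAt_radialUnit {n : WithTop ℕ∞} {x : E} (hx : x ≠ 0) : ContDiffAt ℝ n radialUnit x :=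
  ((contDiffAt_norm ℝ hx).inv (norm_ne_zero_iff.2 hx)).smul contDiffAt_id

theorem radialUnit_smul {r : ℝ} (hr : 0 < r) (x : E) : radialUnit (r • x) = radialUnit x := by
  rw [radialUnit, radialUnit, norm_smul, Real.norm_of_nonneg hr.le, mul_inv, smul_smul,
    mul_right_comm, inv_mul_cancel₀ hr.ne', one_mul]

theorem norm_radialUnit {x : E} (hx : x ≠ 0) : ‖radialUnit x‖ = 1 :=
  norm_smul_inv_norm (𝕜 := ℝ) hx

theorem radialUnit_ne_zero {x : E} (hx : x ≠ 0) : radialUnit x ≠ 0 :=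
  norm_ne_zero_iff.1 ((norm_radialUnit hx).trans_ne one_ne_zero)

theorem norm_radialUnit_le (x : E) : ‖radialUnit x‖ ≤ 1 := by
  rw [radialUnit, norm_smul, norm_inv, norm_norm]
  exact inv_mul_le_one

end RadialDirection

section Curl

theorem RadiallySymmetric.exists_hasFDerivAt {κ : E3 → ℝ} (hrad : RadiallySymmetric κ) {x : E3}
    (hx : x ≠ 0) (hκ : DifferentiableAt ℝ κ x) :
    ∃ c : ℝ, HasFDerivAt κ (c • innerSL ℝ x) x := by
  have hnorm : 0 < ‖x‖ := norm_pos_iff.2 hx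
  have hpoint : √(‖x‖ ^ 2) • radialUnit x = x := by
    rw [Real.sqrt_sq hnorm.le, radialUnit, smul_inv_smul₀ hnorm.ne']
  set g : ℝ → ℝ := fun s => κ (√s • radialUnit x) with hg
  have hg_diff : DifferentiableAt ℝ g (‖x‖ ^ 2) := by
    rw [← hpoint] at hκ
    exact hκ.comp (‖x‖ ^ 2)
      ((Real.hasDerivAt_sqrt (pow_pos hnorm 2).ne').differentiableAt.smul_const _)
  have hκ_eq : κ = fun y => g (‖y‖ ^ 2) := by
    funext y
    refine hrad _ _ ?_
    rw [norm_smul, norm_radialUnit hx, mul_one, Real.sqrt_sq (norm_nonneg y), norm_norm]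
  refine ⟨deriv g (‖x‖ ^ 2) * 2, ?_⟩
  rw [hκ_eq]
  refine (hg_diff.hasDerivAt.comp_hasFDerivAt x
    (hasStrictFDerivAt_norm_sq x).hasFDerivAt).congr_fderiv ?_
  rw [mul_smul, two_smul, two_smul]

theorem curl_eq_zero_of_partialDeriv_symm {F : E3 → E3} {x : E3}
    (h : ∀ i j, partialDeriv F i j x = partialDeriv F j i x) : curl F x = 0 := by
  simp only [curl, h 1 2, h 2 0, h 0 1, sub_self]
  ext i
  fin_cases i <;> rfl

theorem curl_smul_id_eq_zero {κ : E3 → ℝ} (hrad : RadiallySymmetric κ) {x : E3} (hx : x ≠ 0)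
    (hκ : DifferentiableAt ℝ κ x) : curl (fun y => κ y • y) x = 0 := by
  obtain ⟨c, hc⟩ := hrad.exists_hasFDerivAt hx hκ
  have hF : HasFDerivAt (fun y => κ y • y) _ x := hc.smul (hasFDerivAt_id x)
  refine curl_eq_zero_of_partialDeriv_symm fun i j => ?_
  rw [partialDeriv, partialDeriv, hF.fderiv]
  simp [EuclideanSpace.inner_single_right, eq_comm (a := i)]
  ring

theorem continuous_curl {F : E3 → E3} (hF : ContDiff ℝ 1 F) : Continuous (curl F) := by
  have hpartial (i j : Fin 3) : Continuous (partialDeriv F i j) :=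
    (PiLp.continuous_apply 2 _ j).comp ((hF.continuous_fderiv one_ne_zero).clm_apply
      continuous_const)
  refine (PiLp.continuous_toLp 2 _).comp (continuous_pi fun i => ?_)
  fin_cases i
  · exact (hpartial 1 2).sub (hpartial 2 1)
  · exact (hpartial 2 0).sub (hpartial 0 2)
  · exact (hpartial 0 1).sub (hpartial 1 0)

theorem curl_smul_radialUnit {f : E3 → ℝ} (hrad : RadiallySymmetric f) (hf : Differentiable ℝ f)
    (hF : ContDiff ℝ 1 fun x => f x • radialUnit x) : curl (fun x => f x • radialUnit x) = 0 := by
  refine Continuous.ext_on (dense_compl_singleton 0) (continuous_curl hF) continuous_const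
    fun x hx => ?_
  have hfactor : (fun x => f x • radialUnit x) = fun x => (f x * ‖x‖⁻¹) • x :=
    funext fun y => smul_smul _ _ _
  rw [hfactor]
  refine curl_smul_id_eq_zero (fun y w hyw => by rw [hrad y w hyw, hyw]) hx
    ((hf x).mul (((contDiffAt_norm ℝ hx).differentiableAt one_ne_zero).inv
      (norm_ne_zero_iff.2 hx)))

end Curl

section RootAmplitude

/-- The linear map `L` for which the curve `powers p q` solves `z' = R⁻¹ L z`. -/
def powersGenerator (p q : ℝ) : ℝ × ℝ →L[ℝ] ℝ × ℝ :=
  (((p - 1) / 2) • ContinuousLinearMap.fst ℝ ℝ ℝ).prod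
    (((q - p) / 2) • ContinuousLinearMap.snd ℝ ℝ ℝ)

/-- The amplitude as a function of the root `u = (1 - v)^(1/(q-1))` appearing in (H2). -/
def rootAmplitude (p q u : ℝ) : ℝ := amplitude p q (1 - u ^ (q - 1))

/-- The logarithmic derivative `d log R / d log u` of `R = rootAmplitude p q u`, as a smooth
function of `z = powers p q R`. -/
def logRate (p q : ℝ) (z : ℝ × ℝ) : ℝ := (q - 1) * (defect p q z / rate p q z)

/-- The derivative of `R * logRate p q (powers p q R)` with respect to `R`, as a continuous function
of `z = powers p q R`. -/
def logRateSlope (p q : ℝ) (z : ℝ × ℝ) : ℝ :=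
  logRate p q z + fderiv ℝ (logRate p q) z (powersGenerator p q z)

variable {p q : ℝ}

theorem hasDerivAt_powers_generator {R : ℝ} (hR : 0 < R) :
    HasDerivAt (powers p q) (R⁻¹ • powersGenerator p q (powers p q R)) R := by
  refine (hasDerivAt_powers hR).congr_deriv (Prod.ext ?_ ?_) <;>
  · simp only [powersGenerator, ContinuousLinearMap.prod_apply, smul_apply,
      ContinuousLinearMap.coe_fst', smul_eq_mul, ContinuousLinearMap.coe_snd', Prod.smul_mk]
    ring

variable (hp : 1 < p) (hpq : p < q) {u v : ℝ}
include hp hpq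

theorem contDiff_logRate : ContDiff ℝ 2 (logRate p q) :=
  contDiff_const.mul
    ((contDiff_defect hp hpq).div (contDiff_rate hp hpq) fun z => (rate_pos hp hpq z).ne')

theorem continuous_logRateSlope : Continuous (logRateSlope p q) := by
  have hlog := contDiff_logRate hp hpq
  have := hlog.continuous
  have := hlog.continuous_fderiv two_ne_zero
  unfold logRateSlope
  fun_prop

theorem hasDerivAt_mul_logRate {R : ℝ} (hR : 0 < R) :
    HasDerivAt (fun R => R * logRate p q (powers p q R)) (logRateSlope p q (powers p q R)) R := by
  have hlog := ((contDiff_logRate hp hpq).differentiable two_ne_zero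
    (powers p q R)).hasFDerivAt.comp_hasDerivAt R (hasDerivAt_powers_generator hR)
  refine ((hasDerivAt_id R).mul hlog).congr_deriv ?_
  simp only [logRateSlope, Function.comp_apply, id, one_mul, map_smul, smul_eq_mul]
  rw [mul_inv_cancel_left₀ hR.ne']

theorem one_sub_rpow_mem_Ioo (hu : u ∈ Set.Ioo 0 1) : 1 - u ^ (q - 1) ∈ Set.Ioo (0 : ℝ) 1 :=
  ⟨sub_pos.2 (Real.rpow_lt_one hu.1.le hu.2 (by linarith)),
    sub_lt_self _ (Real.rpow_pos_of_pos hu.1 _)⟩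

theorem rootAmplitude_zero : rootAmplitude p q 0 = 0 := by
  rw [rootAmplitude, Real.zero_rpow (by linarith), sub_zero, amplitude_one hp hpq]

theorem rootAmplitude_pos (hu : u ∈ Set.Ioo 0 1) : 0 < rootAmplitude p q u :=
  have hv := one_sub_rpow_mem_Ioo hp hpq hu
  amplitude_pos hp hpq hv.1 hv.2

theorem rpow_mul_eq_rootAmplitude (hu : u ∈ Set.Ioo 0 1) :
    2 * Real.pi * u ^ (q - 1)
      = rootAmplitude p q u ^ (p - 1) * defect p q (powers p q (rootAmplitude p q u)) := by
  have hv := one_sub_rpow_mem_Ioo hp hpq hu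
  have := two_pi_mul_one_sub hp hpq hv.1 hv.2.le
  rwa [sub_sub_cancel] at this

theorem contDiffAt_rootAmplitude (hu : u ∈ Set.Ioo 0 1) :
    ContDiffAt ℝ 2 (rootAmplitude p q) u :=
  have hv := one_sub_rpow_mem_Ioo hp hpq hu
  (contDiffAt_amplitude hp hpq hv.1 hv.2).comp u
    (contDiffAt_const.sub (Real.contDiffAt_rpow_const_of_ne hu.1.ne'))

theorem hasDerivAt_rootAmplitude (hu : u ∈ Set.Ioo 0 1) :
    HasDerivAt (rootAmplitude p q)
      (rootAmplitude p q u * logRate p q (powers p q (rootAmplitude p q u)) / u) u := by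
  have hv := one_sub_rpow_mem_Ioo hp hpq hu
  have hR := rootAmplitude_pos hp hpq hu
  have hrpow := (Real.hasDerivAt_rpow_const (p := q - 1) (Or.inl hu.1.ne')).const_sub 1
  have hderiv : HasDerivAt (rootAmplitude p q)
      (-(2 * Real.pi) / (rootAmplitude p q u ^ (p - 1) / rootAmplitude p q u
        * rate p q (powers p q (rootAmplitude p q u))) * -((q - 1) * u ^ (q - 1 - 1))) u :=
    (hasDerivAt_amplitude hp hpq hv.1 hv.2).comp u hrpow
  refine hderiv.congr_deriv ?_
  have hdefect := rpow_mul_eq_rootAmplitude hp hpq hu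
  rw [Real.rpow_sub_one hu.1.ne' (q - 1), logRate]
  have hrate := (rate_pos hp hpq (powers p q (rootAmplitude p q u))).ne'
  have hpow := (Real.rpow_pos_of_pos hR (p - 1)).ne'
  have hu0 := hu.1.ne'
  field_simp
  linear_combination (q - 1) * hdefect

theorem mul_deriv_deriv_rootAmplitude (hu : u ∈ Set.Ioo 0 1) :
    u * deriv (deriv (rootAmplitude p q)) u = deriv (rootAmplitude p q) u
      * (logRateSlope p q (powers p q (rootAmplitude p q u)) - 1) := by
  have hderiv : deriv (rootAmplitude p q) =ᶠ[𝓝 u]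
      fun u => rootAmplitude p q u * logRate p q (powers p q (rootAmplitude p q u)) / u :=
    Filter.eventually_of_mem (isOpen_Ioo.mem_nhds hu)
      fun u hu => (hasDerivAt_rootAmplitude hp hpq hu).deriv
  have hψ := hasDerivAt_rootAmplitude hp hpq hu
  have hquot : HasDerivAt
      (fun u => rootAmplitude p q u * logRate p q (powers p q (rootAmplitude p q u)) / u) _ u :=
    ((hasDerivAt_mul_logRate hp hpq (rootAmplitude_pos hp hpq hu)).comp u hψ).div (hasDerivAt_id u)
      hu.1.ne'
  have hu0 := hu.1.ne'
  rw [hderiv.deriv_eq, hquot.deriv, hψ.deriv]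
  simp only [Function.comp_apply]
  field_simp

theorem tendsto_rootAmplitude : Filter.Tendsto (rootAmplitude p q) (𝓝[>] 0) (𝓝 0) := by
  refine tendsto_order.2 ⟨fun a ha => ?_, fun ε hε => ?_⟩
  · filter_upwards [Ioo_mem_nhdsGT one_pos] with u hu
    exact ha.trans (rootAmplitude_pos hp hpq hu)
  · have hlim : Filter.Tendsto (fun u : ℝ => 2 * Real.pi * (1 - u ^ (q - 1))) (𝓝[>] 0)
        (𝓝 (2 * Real.pi)) := by
      have hcont : Continuous fun u : ℝ => 2 * Real.pi * (1 - u ^ (q - 1)) :=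
        continuous_const.mul (continuous_const.sub
          (Real.continuous_rpow_const (by linarith)))
      have := (hcont.tendsto 0).mono_left (nhdsWithin_le_nhds (s := Set.Ioi 0))
      rwa [Real.zero_rpow (by linarith), sub_zero, mul_one] at this
    have hperiod : period p q ε < 2 * Real.pi := by
      rw [← period_zero hp hpq]
      exact period_strictAntiOn hp hpq Set.self_mem_Ici hε.le hε
    filter_upwards [Ioo_mem_nhdsGT one_pos, hlim.eventually (lt_mem_nhds hperiod)] with u hu hlt
    have hv := one_sub_rpow_mem_Ioo hp hpq hu
    exact (amplitude_lt_iff hp hpq hv.1 hv.2.le hε.le).2 hlt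

theorem tendsto_comp_powers_rootAmplitude {f : ℝ × ℝ → ℝ} (hf : Continuous f) :
    Filter.Tendsto (fun u => f (powers p q (rootAmplitude p q u))) (𝓝[>] 0) (𝓝 (f 0)) := by
  rw [← powers_zero hp hpq]
  exact ((hf.comp (continuous_powers hp hpq)).tendsto 0).comp (tendsto_rootAmplitude hp hpq)

theorem rpow_eq_rpow_mul_rpow {R : ℝ} (hR : 0 ≤ R) :
    R ^ (q - 1) = R ^ (p - 1) * R ^ (q - p) := by
  rw [← Real.rpow_add_of_nonneg hR (by linarith) (by linarith), sub_add_sub_cancel']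

/-- Near `0` the amplitude satisfies `2π u^(q-1) = R^(p-1) * defect`, where `defect` dominates
`2π R^(q-p)`. -/
theorem eventually_rootAmplitude_le : ∀ᶠ u in 𝓝[>] 0, rootAmplitude p q u ≤ u := by
  have hpow : Filter.Tendsto (fun u => rootAmplitude p q u ^ (q - p)) (𝓝[>] 0) (𝓝 0) := by
    have := ((Real.continuous_rpow_const (by linarith : 0 ≤ q - p)).tendsto 0).comp
      (tendsto_rootAmplitude hp hpq)
    rwa [Real.zero_rpow (by linarith : q - p ≠ 0)] at this
  have hdefect := (tendsto_comp_powers_rootAmplitude hp hpq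
    (contDiff_defect hp hpq).continuous).div_const (2 * Real.pi)
  filter_upwards [Ioo_mem_nhdsGT one_pos, hpow.eventually_lt hdefect
    (div_pos (defect_pos hp hpq 0) Real.two_pi_pos)] with u hu hlt
  have hR := rootAmplitude_pos hp hpq hu
  rw [lt_div_iff₀ Real.two_pi_pos] at hlt
  rw [← Real.rpow_le_rpow_iff hR.le hu.1.le (by linarith : 0 < q - 1)]
  refine le_of_mul_le_mul_left ?_ Real.two_pi_pos
  calc 2 * Real.pi * rootAmplitude p q u ^ (q - 1)
      = rootAmplitude p q u ^ (p - 1) * (rootAmplitude p q u ^ (q - p) * (2 * Real.pi)) := by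
        rw [rpow_eq_rpow_mul_rpow hp hpq hR.le]
        ring
    _ ≤ rootAmplitude p q u ^ (p - 1) * defect p q (powers p q (rootAmplitude p q u)) := by
        gcongr
    _ = 2 * Real.pi * u ^ (q - 1) := (rpow_mul_eq_rootAmplitude hp hpq hu).symm

theorem deriv_rootAmplitude_isBigO :
    deriv (rootAmplitude p q) =O[𝓝[>] 0] fun _ => (1 : ℝ) := by
  have hquot : (fun u => rootAmplitude p q u / u) =O[𝓝[>] 0] fun _ => (1 : ℝ) := by
    refine Asymptotics.IsBigO.of_bound 1 ?_
    filter_upwards [Ioo_mem_nhdsGT one_pos, eventually_rootAmplitude_le hp hpq] with u hu hle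
    have hR := rootAmplitude_pos hp hpq hu
    rw [norm_one, mul_one, Real.norm_of_nonneg (div_nonneg hR.le hu.1.le)]
    exact div_le_one_of_le₀ hle hu.1.le
  have hlog := (tendsto_comp_powers_rootAmplitude hp hpq
    (contDiff_logRate hp hpq).continuous).isBigO_one ℝ
  have hmul := hquot.mul hlog
  rw [mul_one] at hmul
  refine hmul.congr' ?_ .rfl
  filter_upwards [Ioo_mem_nhdsGT one_pos] with u hu
  rw [(hasDerivAt_rootAmplitude hp hpq hu).deriv, div_mul_eq_mul_div]

theorem mul_deriv_deriv_rootAmplitude_isBigO :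
    (fun u => u * deriv (deriv (rootAmplitude p q)) u) =O[𝓝[>] 0] fun _ => (1 : ℝ) := by
  have hslope := ((tendsto_comp_powers_rootAmplitude hp hpq
    (continuous_logRateSlope hp hpq)).sub_const 1).isBigO_one ℝ
  have hmul := (deriv_rootAmplitude_isBigO hp hpq).mul hslope
  rw [mul_one] at hmul
  refine hmul.congr' ?_ .rfl
  filter_upwards [Ioo_mem_nhdsGT one_pos] with u hu
  exact (mul_deriv_deriv_rootAmplitude hp hpq hu).symm

theorem FlatOn.rootAmplitude_comp {V : Type*} [NormedAddCommGroup V] [NormedSpace ℝ V]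
    [ProperSpace V] {K : Set V} {U : V → ℝ} (hK : IsClosed K) (hU : FlatOn 2 K U)
    (hmem : ∀ z ∉ K, U z ∈ Set.Ioo 0 1) : FlatOn 2 K (rootAmplitude p q ∘ U) := by
  obtain ⟨C₁, hC₁⟩ := (deriv_rootAmplitude_isBigO hp hpq).bound
  obtain ⟨C₂, hC₂⟩ := (mul_deriv_deriv_rootAmplitude_isBigO hp hpq).bound
  simp only [norm_one, mul_one, Real.norm_eq_abs] at hC₁ hC₂
  exact hU.real_comp hK (fun z hz => (hmem z hz).1)
    (fun z hz => contDiffAt_rootAmplitude hp hpq (hmem z hz)) (rootAmplitude_zero hp hpq)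
    (tendsto_rootAmplitude hp hpq) (hC₁.mono fun _ h => h.trans (le_max_left C₁ C₂))
    (hC₂.mono fun _ h => h.trans (le_max_right C₁ C₂))

end RootAmplitude

section Decay

theorem exists_pos_forall_le_of_tendsto_cocompact {X : Type*} [TopologicalSpace X] [Nonempty X]
    {f : X → ℝ} {a : ℝ} (hf : Continuous f) (hpos : ∀ x, 0 < f x) (ha : 0 < a)
    (hlim : Filter.Tendsto f (Filter.cocompact X) (𝓝 a)) : ∃ c, 0 < c ∧ ∀ x, c ≤ f x := by
  obtain ⟨x₀⟩ := ‹Nonempty X›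
  have hevent : ∀ᶠ x in Filter.cocompact X, min (f x₀) (a / 2) ≤ min (f x) (a / 2) :=
    (hlim.eventually (lt_mem_nhds (half_lt_self ha))).mono fun x hx => by
      rw [min_eq_right hx.le]
      exact min_le_right _ _
  obtain ⟨x, hx⟩ := (hf.min continuous_const).exists_forall_le' x₀ hevent
  exact ⟨_, lt_min (hpos x) (half_pos ha), fun y => (hx y).trans (min_le_left _ _)⟩

variable {p q : ℝ} (hp : 1 < p) (hpq : p < q) {v₀ : ℝ}
include hp hpq

theorem exists_amplitude_rpow_le (hv₀ : 0 < v₀) :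
    ∃ C, ∀ v ∈ Set.Icc v₀ 1, amplitude p q v ^ (q - 1) ≤ C * (1 - v) := by
  have hcont : Continuous fun R : ℝ => R ^ (q - p) / defect p q (powers p q R) :=
    (Real.continuous_rpow_const (by linarith)).div
      ((contDiff_defect hp hpq).continuous.comp (continuous_powers hp hpq))
      fun R => (defect_pos hp hpq _).ne'
  obtain ⟨C, hC⟩ := (isCompact_Icc (a := 0)
    (b := amplitude p q v₀)).exists_bound_of_continuousOn hcont.continuousOn
  refine ⟨C * (2 * Real.pi), fun v hv => ?_⟩
  have hv_pos := hv₀.trans_le hv.1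
  have hR := amplitude_nonneg hp hpq hv_pos hv.2
  have hle := (le_abs_self _).trans (hC _ ⟨hR, (amplitude_strictAntiOn hp hpq).antitoneOn
    ⟨hv₀, hv.1.trans hv.2⟩ ⟨hv_pos, hv.2⟩ hv.1⟩)
  rw [div_le_iff₀ (defect_pos hp hpq _)] at hle
  calc amplitude p q v ^ (q - 1)
      = amplitude p q v ^ (p - 1) * amplitude p q v ^ (q - p) :=
        rpow_eq_rpow_mul_rpow hp hpq hR
    _ ≤ amplitude p q v ^ (p - 1) * (C * defect p q (powers p q (amplitude p q v))) := by
        gcongr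
    _ = C * (2 * Real.pi) * (1 - v) := by
        linear_combination -C * two_pi_mul_one_sub hp hpq hv_pos hv.2

end Decay

/-- The conditions on `σ`, normalised to `σ(0) = 1`, under which the amplitude `R(x)` with
`period p q (R x) = 2π σ(x)` defines a `C²`-function that is flat at the origin. -/
structure FrequencyProfile (q : ℝ) (σ : E3 → ℝ) : Prop where
  contDiff : ContDiff ℝ 2 σ
  pos : ∀ x, 0 < σ x
  map_zero : σ 0 = 1
  lt_one : ∀ x, x ≠ 0 → σ x < 1
  tendstoZeroC2 : TendstoZeroC2 fun x => |1 - σ x| ^ (1 / (q - 1))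

namespace FrequencyProfile

variable {p q : ℝ} {σ : E3 → ℝ} (hσ : FrequencyProfile q σ)
include hσ

theorem le_one (x : E3) : σ x ≤ 1 := by
  rcases eq_or_ne x 0 with rfl | hx
  · exact hσ.map_zero.le
  · exact (hσ.lt_one x hx).le

theorem flatOn_root (hq : 1 < q) :
    FlatOn 2 {0} fun x => |1 - σ x| ^ (1 / (q - 1)) := by
  refine flatOn_two_of_tendsto isClosed_singleton ?_ (fun x hx => ?_) ?_ ?_ ?_
  · rintro _ rfl
    rw [hσ.map_zero, sub_self, abs_zero,
      Real.zero_rpow (one_div_ne_zero (sub_pos.2 hq).ne')]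
  · have hne : 1 - σ x ≠ 0 := (sub_pos.2 (hσ.lt_one x hx)).ne'
    have habs : ContDiffAt ℝ 2 (fun x => |1 - σ x|) x :=
      (contDiffAt_const.sub hσ.contDiff.contDiffAt).abs hne
    exact habs.rpow_const_of_ne (abs_ne_zero.2 hne)
  · rintro _ rfl
    exact hσ.tendstoZeroC2.1
  · rintro _ rfl
    exact tendsto_norm_zero.comp hσ.tendstoZeroC2.2.1
  · rintro _ rfl
    exact (tendsto_norm_zero (E := E3 →L[ℝ] E3 →L[ℝ] ℝ)).comp hσ.tendstoZeroC2.2.2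

theorem root_rpow (hq : 1 < q) (x : E3) : (|1 - σ x| ^ (1 / (q - 1))) ^ (q - 1) = 1 - σ x := by
  rw [one_div, Real.rpow_inv_rpow (abs_nonneg _) (sub_pos.2 hq).ne',
    abs_of_nonneg (sub_nonneg.2 (hσ.le_one x))]

theorem root_mem_Ioo (hq : 1 < q) {x : E3} (hx : x ≠ 0) :
    |1 - σ x| ^ (1 / (q - 1)) ∈ Set.Ioo (0 : ℝ) 1 := by
  have hlt := sub_pos.2 (hσ.lt_one x hx)
  rw [abs_of_pos hlt]
  exact ⟨Real.rpow_pos_of_pos hlt _, Real.rpow_lt_one hlt.le (sub_lt_self _ (hσ.pos x))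
    (one_div_pos.2 (sub_pos.2 hq))⟩

theorem flatOn_amplitude (hp : 1 < p) (hpq : p < q) :
    FlatOn 2 {0} fun x => amplitude p q (σ x) := by
  have hq := hp.trans hpq
  have hamp : (fun x => amplitude p q (σ x))
      = rootAmplitude p q ∘ fun x => |1 - σ x| ^ (1 / (q - 1)) := funext fun x => by
    rw [Function.comp_apply, rootAmplitude, hσ.root_rpow hq, sub_sub_cancel]
  rw [hamp]
  exact (hσ.flatOn_root hq).rootAmplitude_comp hp hpq isClosed_singleton
    fun x hx => hσ.root_mem_Ioo hq hx

theorem exists_pos_le {κ : ℝ} (hκ : 0 < κ)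
    (hdecay : BddAbove (Set.range fun x : E3 => |1 - σ x| * Real.exp (κ * ‖x‖))) :
    ∃ c, 0 < c ∧ ∀ x, c ≤ σ x := by
  obtain ⟨A, hA⟩ := hdecay
  refine exists_pos_forall_le_of_tendsto_cocompact hσ.contDiff.continuous hσ.pos one_pos ?_
  have hexp : Filter.Tendsto (fun x : E3 => A * Real.exp (-(κ * ‖x‖))) (Filter.cocompact E3)
      (𝓝 0) := by
    simpa only [mul_zero, Function.comp_def] using (Real.tendsto_exp_neg_atTop_nhds_zero.comp
      ((tendsto_norm_cocompact_atTop (E := E3)).const_mul_atTop hκ)).const_mul A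
  refine tendsto_iff_norm_sub_tendsto_zero.2 (squeeze_zero (fun _ => norm_nonneg _) (fun x => ?_)
    hexp)
  rw [Real.norm_eq_abs, abs_sub_comm, Real.exp_neg, ← div_eq_mul_inv, le_div_iff₀ (Real.exp_pos _)]
  exact hA ⟨x, rfl⟩

theorem bddAbove_amplitude_mul_exp (hp : 1 < p) (hpq : p < q) {γ : ℝ} (hγ : 0 < γ)
    (hdecay : BddAbove (Set.range fun x : E3 => |1 - σ x| * Real.exp (γ * (q - 1) * ‖x‖))) :
    BddAbove (Set.range fun x : E3 => amplitude p q (σ x) * Real.exp (γ * ‖x‖)) := by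
  have hq : 0 < q - 1 := by linarith
  obtain ⟨c, hc, hcσ⟩ := hσ.exists_pos_le (mul_pos hγ hq) hdecay
  obtain ⟨C, hC⟩ := exists_amplitude_rpow_le hp hpq hc
  obtain ⟨A, hA⟩ := hdecay
  refine ⟨(|C| * A) ^ (q - 1)⁻¹, ?_⟩
  rintro _ ⟨x, rfl⟩
  have hR := amplitude_nonneg hp hpq (hσ.pos x) (hσ.le_one x)
  have hexp := Real.exp_pos (γ * ‖x‖)
  have hpow : (amplitude p q (σ x) * Real.exp (γ * ‖x‖)) ^ (q - 1) ≤ |C| * A :=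
    calc (amplitude p q (σ x) * Real.exp (γ * ‖x‖)) ^ (q - 1)
        = amplitude p q (σ x) ^ (q - 1) * Real.exp (γ * (q - 1) * ‖x‖) := by
          rw [Real.mul_rpow hR hexp.le, ← Real.exp_mul, mul_right_comm]
      _ ≤ C * (1 - σ x) * Real.exp (γ * (q - 1) * ‖x‖) := by
          gcongr
          exact hC _ ⟨hcσ x, hσ.le_one x⟩
      _ ≤ |C| * |1 - σ x| * Real.exp (γ * (q - 1) * ‖x‖) := by
          gcongr
          · exact sub_nonneg.2 (hσ.le_one x)
          · exact le_abs_self C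
          · exact le_abs_self (1 - σ x)
      _ ≤ |C| * A := by
          rw [mul_assoc]
          gcongr
          exact hA ⟨x, rfl⟩
  have hbase := mul_nonneg hR hexp.le
  exact (Real.le_rpow_inv_iff_of_pos hbase ((Real.rpow_nonneg hbase _).trans hpow) hq).2 hpow

end FrequencyProfile

section PhaseShift

theorem exists_contDiff_eq_norm {f : E3 × ℝ → ℝ} (hf : ContDiff ℝ 2 f)
    (hrad : ∀ t, RadiallySymmetric fun x => f (x, t)) :
    ∃ y : ℝ → ℝ → ℝ, ContDiff ℝ 2 (fun z : ℝ × ℝ => y z.1 z.2) ∧ ∀ x t, f (x, t) = y ‖x‖ t := by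
  obtain ⟨e, he⟩ := exists_norm_eq E3 zero_le_one
  refine ⟨fun r t => f (r • e, t),
    hf.comp ((contDiff_fst.smul contDiff_const).prodMk contDiff_snd), fun x t => hrad t x _ ?_⟩
  rw [norm_smul, he, norm_norm, mul_one]

variable {u : E3 → ℝ → E3} {b : E3 → ℝ}

theorem contDiff_phaseShift {n : WithTop ℕ∞} (hu : ContDiff ℝ n fun z : E3 × ℝ => u z.1 z.2)
    (hb : ContDiff ℝ n b) : ContDiff ℝ n fun z : E3 × ℝ => phaseShift u b z.1 z.2 :=
  hu.comp (contDiff_fst.prodMk (contDiff_snd.add (hb.comp contDiff_fst)))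

theorem curl_phaseShift_smul_radialUnit {f : E3 × ℝ → ℝ} (hf : ContDiff ℝ 2 f)
    (hrad : ∀ t, RadiallySymmetric fun x => f (x, t))
    (hu : ContDiff ℝ 2 fun z : E3 × ℝ => f z • radialUnit z.1)
    (hb : ContDiff ℝ 2 b) (hb_rad : RadiallySymmetric b) (t : ℝ) :
    curl (fun x => phaseShift (fun x t => f (x, t) • radialUnit x) b x t) = 0 := by
  have hslice : ContDiff ℝ 2 fun x => (x, t + b x) := contDiff_id.prodMk (contDiff_const.add hb)
  refine curl_smul_radialUnit (f := fun x => f (x, t + b x)) (fun x y h => ?_)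
    ((hf.comp hslice).differentiable two_ne_zero) ((hu.comp hslice).of_le one_le_two)
  simp only [hb_rad x y h]
  exact hrad _ x y h

variable {ρ μ vp vq : E3 → ℝ} {M : E3 → Matrix (Fin 3) (Fin 3) ℝ} {p q T γ : ℝ}

theorem curl_matCurl_eq_zero {F : E3 → E3} (hF : curl F = 0) :
    matCurl M F = 0 ∧ curl (matCurl M F) = 0 := by
  have hmat : matCurl M F = 0 := funext fun x => by
    rw [matCurl, hF, Pi.zero_apply, map_zero]
  refine ⟨hmat, funext fun x => curl_eq_zero_of_partialDeriv_symm fun i j => ?_⟩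
  rw [hmat, partialDeriv, partialDeriv, fderiv_zero]
  rfl

theorem isClassicalSolution_iff_of_curl_eq_zero (hcurl : ∀ t, curl (fun x => u x t) = 0) :
    IsClassicalSolution ρ μ vp vq M p q u ↔ ContDiff ℝ 2 (fun z : E3 × ℝ => u z.1 z.2) ∧
      ∀ x t, ρ x • iteratedDeriv 2 (u x) t + μ x • u x t
        + (vp x * ‖u x t‖ ^ (p - 1)) • u x t + (vq x * ‖u x t‖ ^ (q - 1)) • u x t = 0 := by
  have hmat t := curl_matCurl_eq_zero (M := M) (hcurl t)
  constructor
  · rintro ⟨hu, -, h⟩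
    refine ⟨hu, fun x t => ?_⟩
    simpa only [(hmat t).2, Pi.zero_apply, add_zero] using h x t
  · rintro ⟨hu, h⟩
    refine ⟨hu, fun t => ?_, fun x t => ?_⟩
    · rw [(hmat t).1]
      exact differentiable_const _
    · simpa only [(hmat t).2, Pi.zero_apply, add_zero] using h x t

theorem IsBreather.phaseShift (hu : IsBreather ρ μ vp vq M p q T γ u)
    (hcurl : ∀ t, curl (fun x => u x t) = 0) (hb : ContDiff ℝ 2 b)
    (hcurl_shift : ∀ t, curl (fun x => phaseShift u b x t) = 0) :
    IsBreather ρ μ vp vq M p q T γ (phaseShift u b) where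
  isClassicalSolution := by
    obtain ⟨hC2, heq⟩ := (isClassicalSolution_iff_of_curl_eq_zero hcurl).1 hu.isClassicalSolution
    refine (isClassicalSolution_iff_of_curl_eq_zero hcurl_shift).2
      ⟨contDiff_phaseShift hC2 hb, fun x t => ?_⟩
    have hderiv : iteratedDeriv 2 (CurlCurl.phaseShift u b x) t = iteratedDeriv 2 (u x) (t + b x) :=
      congrFun (iteratedDeriv_comp_add_const 2 (u x) (b x)) t
    rw [hderiv]
    exact heq x (t + b x)
  nontrivial := by
    obtain ⟨x, t, h⟩ := hu.nontrivial
    exact ⟨x, t - b x, by rwa [CurlCurl.phaseShift, sub_add_cancel]⟩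
  periodic x t := by
    rw [CurlCurl.phaseShift, add_right_comm]
    exact hu.periodic x (t + b x)
  localized := hu.localized.mono (by
    rintro _ ⟨⟨x, t⟩, rfl⟩
    exact ⟨(x, t + b x), rfl⟩)

theorem mk_range_le_mk_phaseShift (u : E3 → ℝ → E3) (x : E3) :
    Cardinal.mk (Set.range (u x)) ≤ Cardinal.mk {v : E3 → ℝ → E3 // ∃ b : E3 → ℝ,
      ContDiff ℝ 2 b ∧ RadiallySymmetric b ∧ v = phaseShift u b} := by
  refine Cardinal.mk_le_of_surjective (f := fun v => ⟨v.1 x 0, ?_⟩) ?_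
  · obtain ⟨v, b, -, -, rfl⟩ := v
    exact ⟨0 + b x, rfl⟩
  · rintro ⟨_, s, rfl⟩
    refine ⟨⟨_, fun _ => s, contDiff_const, fun _ _ _ => rfl, rfl⟩, Subtype.ext ?_⟩
    simp only [phaseShift, zero_add]

end PhaseShift

section RadialWave

/-- The scalar profile `τ(x) w(σ(x) t)` of the breather, where `w` is the wave of period
`2π σ(x)`. -/
def profile (p q : ℝ) (τ σ : E3 → ℝ) (z : E3 × ℝ) : ℝ :=
  τ z.1 * wave p q (amplitude p q (σ z.1)) (σ z.1 * z.2)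

/-- The breather: the radial field with scalar profile `profile p q τ σ`. -/
def radialWave (p q : ℝ) (τ σ : E3 → ℝ) (x : E3) (t : ℝ) : E3 :=
  profile p q τ σ (x, t) • radialUnit x

variable {p q : ℝ} {τ σ : E3 → ℝ}

theorem radialWave_zero (t : ℝ) : radialWave p q τ σ 0 t = 0 := by
  rw [radialWave, radialUnit, smul_zero, smul_zero]

theorem radiallySymmetric_profile (hτ : RadiallySymmetric τ) (hσ : RadiallySymmetric σ) (t : ℝ) :
    RadiallySymmetric fun x => profile p q τ σ (x, t) := fun x y h => by
  simp only [profile, hτ x y h, hσ x y h]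

variable (hp : 1 < p) (hpq : p < q)
include hp hpq

theorem wave_add_period (R s : ℝ) : wave p q R (s + period p q R) = wave p q R s := by
  rw [wave, period, phase_add_period hp (hp.trans hpq), Real.sin_add_two_pi, wave]

theorem FlatOn.wave_comp {V : Type*} [NormedAddCommGroup V] [NormedSpace ℝ V] [ProperSpace V]
    {K : Set V} {R s : V → ℝ} (hK : IsClosed K) (hR : FlatOn 2 K R) (hR_pos : ∀ z ∉ K, 0 < R z)
    (hs : ContDiff ℝ 2 s) : FlatOn 2 K fun z => wave p q (R z) (s z) := by
  simpa only [wave, mul_comm, Function.comp_apply] using hR.comp_curve_mul hK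
    (continuous_powers hp hpq) (fun _ hr => hasDerivAt_powers_generator hr) hR_pos
    (fun _ hr => contDiffAt_powers hr) hs
    (Real.contDiff_sin.comp (contDiff_phase hp (hp.trans hpq)))

theorem flatOn_profile (hτ : ContDiff ℝ 2 τ) (hσ : FrequencyProfile q σ) :
    FlatOn 2 (Prod.fst ⁻¹' {0}) (profile p q τ σ) := by
  have hK : IsClosed (Prod.fst ⁻¹' {0} : Set (E3 × ℝ)) := isClosed_singleton.preimage continuous_fst
  have hR := (hσ.flatOn_amplitude hp hpq).comp_continuousLinearMap (ContinuousLinearMap.fst ℝ E3 ℝ)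
  have hwave := hR.wave_comp hp hpq hK
    (fun z hz => amplitude_pos hp hpq (hσ.pos z.1) (hσ.lt_one z.1 hz))
    ((hσ.contDiff.comp contDiff_fst).mul contDiff_snd)
  exact hwave.smul hK (hτ.comp contDiff_fst)

theorem contDiff_radialWave (hτ : ContDiff ℝ 2 τ) (hσ : FrequencyProfile q σ) :
    ContDiff ℝ 2 fun z : E3 × ℝ => radialWave p q τ σ z.1 z.2 :=
  ((flatOn_profile hp hpq hτ hσ).smul_comp_fst (fun _ hx => contDiffAt_radialUnit hx)
    fun _ hr x => radialUnit_smul hr x).contDiff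

theorem curl_phaseShift_radialWave (hτ : ContDiff ℝ 2 τ) (hτ_rad : RadiallySymmetric τ)
    (hσ : FrequencyProfile q σ) (hσ_rad : RadiallySymmetric σ) {b : E3 → ℝ}
    (hb : ContDiff ℝ 2 b) (hb_rad : RadiallySymmetric b) (t : ℝ) :
    curl (fun x => phaseShift (radialWave p q τ σ) b x t) = 0 :=
  curl_phaseShift_smul_radialUnit (flatOn_profile hp hpq hτ hσ).contDiff
    (radiallySymmetric_profile hτ_rad hσ_rad) (contDiff_radialWave hp hpq hτ hσ) hb hb_rad t

theorem curl_radialWave (hτ : ContDiff ℝ 2 τ) (hτ_rad : RadiallySymmetric τ)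
    (hσ : FrequencyProfile q σ) (hσ_rad : RadiallySymmetric σ) (t : ℝ) :
    curl (fun x => radialWave p q τ σ x t) = 0 := by
  simpa only [phaseShift, add_zero] using curl_phaseShift_radialWave hp hpq hτ hτ_rad hσ hσ_rad
    (contDiff_const (c := (0 : ℝ))) (fun _ _ _ => rfl) t

theorem iteratedDeriv_two_radialWave {x : E3} (hR : 0 < amplitude p q (σ x)) (t : ℝ) :
    iteratedDeriv 2 (radialWave p q τ σ x) t = (-(τ x * σ x ^ 2
      * (wave p q (amplitude p q (σ x)) (σ x * t)
        + |wave p q (amplitude p q (σ x)) (σ x * t)| ^ (p - 1)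
          * wave p q (amplitude p q (σ x)) (σ x * t)
        + |wave p q (amplitude p q (σ x)) (σ x * t)| ^ (q - 1)
          * wave p q (amplitude p q (σ x)) (σ x * t)))) • radialUnit x := by
  have hq := hp.trans hpq
  set R := amplitude p q (σ x)
  have hscale (t : ℝ) : HasDerivAt (fun t => σ x * t) (σ x) t := by
    simpa only [mul_one, id] using (hasDerivAt_id t).const_mul (σ x)
  have hfirst (t : ℝ) : HasDerivAt (radialWave p q τ σ x)
      ((τ x * (deriv (wave p q R) (σ x * t) * σ x)) • radialUnit x) t :=
    ((((hasDerivAt_wave hp hq R (σ x * t)).differentiableAt.hasDerivAt).comp t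
      (hscale t)).const_mul (τ x)).smul_const (radialUnit x)
  have hsecond := ((((hasDerivAt_deriv_wave hp hq hR (σ x * t)).comp t (hscale t)).mul_const
    (σ x)).const_mul (τ x)).smul_const (radialUnit x)
  rw [iteratedDeriv_succ, iteratedDeriv_one, funext fun t => (hfirst t).deriv]
  refine hsecond.deriv.trans ?_
  congr 1
  ring

theorem radialWave_equation {ρ μ vp vq : E3 → ℝ} (hτ_pos : ∀ x, 0 < τ x)
    (hσ : FrequencyProfile q σ) (hρσ : ∀ x, ρ x * σ x ^ 2 = μ x)
    (hvp : ∀ x, vp x * τ x ^ (p - 1) = μ x) (hvq : ∀ x, vq x * τ x ^ (q - 1) = μ x)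
    (x : E3) (t : ℝ) :
    ρ x • iteratedDeriv 2 (radialWave p q τ σ x) t + μ x • radialWave p q τ σ x t
      + (vp x * ‖radialWave p q τ σ x t‖ ^ (p - 1)) • radialWave p q τ σ x t
      + (vq x * ‖radialWave p q τ σ x t‖ ^ (q - 1)) • radialWave p q τ σ x t = 0 := by
  rcases eq_or_ne x 0 with rfl | hx
  · rw [funext (radialWave_zero (p := p) (q := q) (τ := τ) (σ := σ))]
    simp
  have hR := amplitude_pos hp hpq (hσ.pos x) (hσ.lt_one x hx)
  have hnorm : ‖radialWave p q τ σ x t‖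
      = τ x * |wave p q (amplitude p q (σ x)) (σ x * t)| := by
    rw [radialWave, norm_smul, norm_radialUnit hx, mul_one, profile, norm_mul,
      Real.norm_of_nonneg (hτ_pos x).le, Real.norm_eq_abs]
  rw [hnorm, iteratedDeriv_two_radialWave hp hpq hR, radialWave, profile,
    Real.mul_rpow (hτ_pos x).le (abs_nonneg _), Real.mul_rpow (hτ_pos x).le (abs_nonneg _)]
  simp only [smul_smul, ← add_smul]
  set w := wave p q (amplitude p q (σ x)) (σ x * t)
  refine smul_eq_zero_of_left ?_ _
  linear_combination (-τ x * (w + |w| ^ (p - 1) * w + |w| ^ (q - 1) * w)) * hρσ x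
    + τ x * |w| ^ (p - 1) * w * hvp x + τ x * |w| ^ (q - 1) * w * hvq x

theorem norm_radialWave_le (hτ_pos : ∀ x, 0 < τ x) (hσ : FrequencyProfile q σ) (x : E3) (t : ℝ) :
    ‖radialWave p q τ σ x t‖ ≤ τ x * amplitude p q (σ x) := by
  have hR := amplitude_nonneg hp hpq (hσ.pos x) (hσ.le_one x)
  have hτ := (hτ_pos x).le
  calc ‖radialWave p q τ σ x t‖
      = τ x * |wave p q (amplitude p q (σ x)) (σ x * t)| * ‖radialUnit x‖ := by
        rw [radialWave, norm_smul, profile, norm_mul, Real.norm_of_nonneg hτ, Real.norm_eq_abs]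
    _ ≤ τ x * amplitude p q (σ x) * 1 := by
        gcongr
        · exact abs_wave_le hR _
        · exact norm_radialUnit_le x
    _ = τ x * amplitude p q (σ x) := mul_one _

theorem bddAbove_norm_radialWave_mul_exp (hτ_pos : ∀ x, 0 < τ x)
    (hτ_bdd : BddAbove (Set.range τ)) (hσ : FrequencyProfile q σ) {γ : ℝ} (hγ : 0 < γ)
    (hdecay : BddAbove (Set.range fun x : E3 => |1 - σ x| * Real.exp (γ * (q - 1) * ‖x‖))) :
    BddAbove (Set.range fun z : E3 × ℝ =>
      ‖radialWave p q τ σ z.1 z.2‖ * Real.exp (γ * ‖z.1‖)) := by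
  obtain ⟨A, hA⟩ := hτ_bdd
  obtain ⟨C, hC⟩ := hσ.bddAbove_amplitude_mul_exp hp hpq hγ hdecay
  refine ⟨A * C, ?_⟩
  rintro _ ⟨⟨x, t⟩, rfl⟩
  have hR := amplitude_nonneg hp hpq (hσ.pos x) (hσ.le_one x)
  have hτA : τ x ≤ A := hA ⟨x, rfl⟩
  calc ‖radialWave p q τ σ x t‖ * Real.exp (γ * ‖x‖)
      ≤ τ x * amplitude p q (σ x) * Real.exp (γ * ‖x‖) := by
        gcongr
        exact norm_radialWave_le hp hpq hτ_pos hσ x t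
    _ = τ x * (amplitude p q (σ x) * Real.exp (γ * ‖x‖)) := mul_assoc _ _ _
    _ ≤ A * C := mul_le_mul hτA (hC ⟨x, rfl⟩) (by positivity) ((hτ_pos x).le.trans hτA)

theorem exists_radialWave_eq (hσ : FrequencyProfile q σ) (x : E3) {a : ℝ}
    (ha : a ∈ Set.Icc (-1 : ℝ) 1) :
    ∃ s, radialWave p q τ σ x s = (τ x * (amplitude p q (σ x) * a)) • radialUnit x := by
  obtain ⟨s, hs⟩ := exists_wave_eq hp (hp.trans hpq) (amplitude p q (σ x)) ha
  exact ⟨s / σ x, by rw [radialWave, profile, mul_div_cancel₀ _ (hσ.pos x).ne', hs]⟩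

theorem continuum_le_mk_range_radialWave (hτ_pos : ∀ x, 0 < τ x) (hσ : FrequencyProfile q σ)
    {x : E3} (hx : x ≠ 0) :
    Cardinal.continuum ≤ Cardinal.mk (Set.range (radialWave p q τ σ x)) := by
  rw [← Cardinal.mk_Icc_real (show (-1 : ℝ) < 1 by norm_num)]
  refine Cardinal.mk_le_of_injective
    (f := fun a => ⟨_, exists_radialWave_eq hp hpq hσ x a.2⟩) fun a a' h => ?_
  have hR := amplitude_pos hp hpq (hσ.pos x) (hσ.lt_one x hx)
  exact Subtype.ext (mul_left_cancel₀ hR.ne' (mul_left_cancel₀ (hτ_pos x).ne'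
    (smul_left_injective ℝ (radialUnit_ne_zero hx) (congrArg Subtype.val h))))

theorem isBreather_radialWave {ρ μ vp vq : E3 → ℝ} {M : E3 → Matrix (Fin 3) (Fin 3) ℝ}
    (hτ : ContDiff ℝ 2 τ) (hτ_pos : ∀ x, 0 < τ x) (hτ_rad : RadiallySymmetric τ)
    (hτ_bdd : BddAbove (Set.range τ)) (hσ : FrequencyProfile q σ) (hσ_rad : RadiallySymmetric σ)
    (hρσ : ∀ x, ρ x * σ x ^ 2 = μ x) (hvp : ∀ x, vp x * τ x ^ (p - 1) = μ x)
    (hvq : ∀ x, vq x * τ x ^ (q - 1) = μ x) {γ : ℝ} (hγ : 0 < γ)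
    (hdecay : BddAbove (Set.range fun x : E3 => |1 - σ x| * Real.exp (γ * (q - 1) * ‖x‖))) :
    IsBreather ρ μ vp vq M p q (2 * Real.pi) γ (radialWave p q τ σ) where
  isClassicalSolution := (isClassicalSolution_iff_of_curl_eq_zero
    (curl_radialWave hp hpq hτ hτ_rad hσ hσ_rad)).2
      ⟨contDiff_radialWave hp hpq hτ hσ, radialWave_equation hp hpq hτ_pos hσ hρσ hvp hvq⟩
  nontrivial := by
    obtain ⟨x, hx⟩ := exists_ne (0 : E3)
    obtain ⟨s, hs⟩ := exists_radialWave_eq hp hpq (τ := τ) hσ x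
      (Set.right_mem_Icc.2 (show (-1 : ℝ) ≤ 1 by norm_num))
    have hR := amplitude_pos hp hpq (hσ.pos x) (hσ.lt_one x hx)
    refine ⟨x, s, hs ▸ smul_ne_zero ?_ (radialUnit_ne_zero hx)⟩
    rw [mul_one]
    exact (mul_pos (hτ_pos x) hR).ne'
  periodic x t := by
    have hperiod := wave_add_period hp hpq (amplitude p q (σ x)) (σ x * t)
    rw [period_amplitude hp hpq (hσ.pos x) (hσ.le_one x)] at hperiod
    rw [radialWave, radialWave, profile, profile, ← hperiod]
    ring_nf
  localized := bddAbove_norm_radialWave_mul_exp hp hpq hτ_pos hτ_bdd hσ hγ hdecay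

end RadialWave

section Coefficients

variable {ρ μ vp vq : E3 → ℝ} {p q : ℝ}

theorem contDiff_sigma {n : WithTop ℕ∞} (hρ : ContDiff ℝ n ρ) (hμ : ContDiff ℝ n μ)
    (hρ_pos : ∀ x, 0 < ρ x) (hμ_pos : ∀ x, 0 < μ x) : ContDiff ℝ n (sigma ρ μ) :=
  (hμ.div hρ fun x => (hρ_pos x).ne').sqrt fun x => (div_pos (hμ_pos x) (hρ_pos x)).ne'

theorem sigma_pos {x : E3} (hρ : 0 < ρ x) (hμ : 0 < μ x) : 0 < sigma ρ μ x :=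
  Real.sqrt_pos.2 (div_pos hμ hρ)

theorem mul_sigma_sq {x : E3} (hρ : 0 < ρ x) (hμ : 0 < μ x) : ρ x * sigma ρ μ x ^ 2 = μ x := by
  rw [sigma, Real.sq_sqrt (div_pos hμ hρ).le, mul_div_cancel₀ _ hρ.ne']

theorem radiallySymmetric_sigma (hρ : RadiallySymmetric ρ) (hμ : RadiallySymmetric μ) :
    RadiallySymmetric (sigma ρ μ) := fun x y h => by
  rw [sigma, sigma, hρ x y h, hμ x y h]

theorem map_zero_eq_one_of_tendsto {σ : E3 → ℝ} (hσ : Continuous σ) (hσ_nonneg : 0 ≤ σ 0)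
    (hq : 1 < q)
    (hU : Filter.Tendsto (fun x => |1 - σ 0 * σ x| ^ (1 / (q - 1))) (𝓝[≠] 0) (𝓝 0)) :
    σ 0 = 1 := by
  have hq' : 0 < 1 / (q - 1) := one_div_pos.2 (sub_pos.2 hq)
  have hcont : Continuous fun x => |1 - σ 0 * σ x| ^ (1 / (q - 1)) :=
    (continuous_const.sub (continuous_const.mul hσ)).abs.rpow_const fun _ => Or.inr hq'.le
  have hzero := tendsto_nhds_unique ((hcont.tendsto 0).mono_left nhdsWithin_le_nhds) hU
  rw [Real.rpow_eq_zero (abs_nonneg _) hq'.ne', abs_eq_zero, sub_eq_zero] at hzero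
  nlinarith

theorem FrequencyProfile.of_mul_lt_one {σ : E3 → ℝ} (hσ : ContDiff ℝ 2 σ)
    (hσ_pos : ∀ x, 0 < σ x) (hq : 1 < q) (hlt : ∀ x, x ≠ 0 → σ 0 * σ x < 1)
    (hU : TendstoZeroC2 fun x => |1 - σ 0 * σ x| ^ (1 / (q - 1))) : FrequencyProfile q σ := by
  have hzero := map_zero_eq_one_of_tendsto hσ.continuous (hσ_pos 0).le hq hU.1
  simp only [hzero, one_mul] at hlt hU
  exact ⟨hσ, hσ_pos, hzero, hlt, hU⟩

theorem contDiff_tau {n : WithTop ℕ∞} (hμ : ContDiff ℝ n μ) (hvq : ContDiff ℝ n vq)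
    (hμ_pos : ∀ x, 0 < μ x) (hvq_pos : ∀ x, 0 < vq x) : ContDiff ℝ n (tau μ vq q) :=
  (hμ.div hvq fun x => (hvq_pos x).ne').rpow_const_of_ne
    fun x => (div_pos (hμ_pos x) (hvq_pos x)).ne'

theorem tau_pos {x : E3} (hμ : 0 < μ x) (hvq : 0 < vq x) : 0 < tau μ vq q x :=
  Real.rpow_pos_of_pos (div_pos hμ hvq) _

theorem radiallySymmetric_tau (hμ : RadiallySymmetric μ) (hvq : RadiallySymmetric vq) :
    RadiallySymmetric (tau μ vq q) := fun x y h => by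
  rw [tau, tau, hμ x y h, hvq x y h]

theorem mul_tau_rpow_self {x : E3} (hμ : 0 < μ x) (hvq : 0 < vq x) (hq : 1 < q) :
    vq x * tau μ vq q x ^ (q - 1) = μ x := by
  rw [tau, ← Real.rpow_mul (div_pos hμ hvq).le, one_div_mul_cancel (sub_pos.2 hq).ne',
    Real.rpow_one, mul_div_cancel₀ _ hvq.ne']

theorem mul_tau_rpow {x : E3} (hμ : 0 < μ x) (hvq : 0 < vq x) (hq : 1 < q)
    (hvp : vp x = (μ x ^ (q - p) / vq x ^ (1 - p)) ^ (1 / (q - 1))) :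
    vp x * tau μ vq q x ^ (p - 1) = μ x := by
  have hμ' := Real.rpow_pos_of_pos hμ (q - p)
  have hvq' := Real.rpow_pos_of_pos hvq (1 - p)
  have hvp_pos := Real.rpow_pos_of_pos (div_pos hμ' hvq') (1 / (q - 1))
  have hτ : 0 < tau μ vq q x := tau_pos hμ hvq
  have hτ' := Real.rpow_pos_of_pos hτ (p - 1)
  have hq' : q - 1 ≠ 0 := (sub_pos.2 hq).ne'
  rw [hvp]
  apply Real.log_injOn_pos (Set.mem_Ioi.2 (mul_pos hvp_pos hτ')) hμ
  rw [Real.log_mul hvp_pos.ne' hτ'.ne', Real.log_rpow hτ, tau, Real.log_rpow (div_pos hμ hvq),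
    Real.log_rpow (div_pos hμ' hvq'), Real.log_div hμ'.ne' hvq'.ne', Real.log_div hμ.ne' hvq.ne',
    Real.log_rpow hμ, Real.log_rpow hvq]
  field_simp
  ring

end Coefficients

end CurlCurl

end

theorem theorem4p1 (p q : ℝ) (hp : 1 < p) (hpq : p < q)
    (ρ μ vp vq : CurlCurl.E3 → ℝ) (M : CurlCurl.E3 → Matrix (Fin 3) (Fin 3) ℝ)
    (hρ : ContDiff ℝ 2 ρ) (hμ : ContDiff ℝ 2 μ) (hvp : ContDiff ℝ 2 vp) (hvq : ContDiff ℝ 2 vq)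
    (hρ_pos : ∀ x, 0 < ρ x) (hμ_pos : ∀ x, 0 < μ x)
    (hvp_pos : ∀ x, 0 < vp x) (hvq_pos : ∀ x, 0 < vq x)
    (hρ_rad : CurlCurl.RadiallySymmetric ρ) (hμ_rad : CurlCurl.RadiallySymmetric μ)
    (hvp_rad : CurlCurl.RadiallySymmetric vp) (hvq_rad : CurlCurl.RadiallySymmetric vq)
    (hV : ∀ x, vp x = (μ x ^ (q - p) / vq x ^ (1 - p)) ^ (1 / (q - 1)))
    (T : ℝ) (hT : T = 2 * Real.pi * CurlCurl.sigma ρ μ 0)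
    (hH1 : ∀ x, x ≠ 0 → CurlCurl.sigma ρ μ 0 * CurlCurl.sigma ρ μ x < 1)
    (hH2 : CurlCurl.TendstoZeroC2
      (fun x => |1 - CurlCurl.sigma ρ μ 0 * CurlCurl.sigma ρ μ x| ^ (1 / (q - 1))))
    (γ : ℝ) (hγ : 0 < γ)
    (hH3 : BddAbove (Set.range fun x : CurlCurl.E3 =>
      |1 - CurlCurl.sigma ρ μ 0 * CurlCurl.sigma ρ μ x| * Real.exp (γ * (q - 1) * ‖x‖)))
    (hH4 : BddAbove (Set.range (CurlCurl.tau μ vq q))) :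
    T = 2 * Real.pi * √(ρ 0 / μ 0) ∧
    ∃ u : CurlCurl.E3 → ℝ → CurlCurl.E3,
      CurlCurl.IsBreather ρ μ vp vq M p q T γ u ∧
      (∃ y : ℝ → ℝ → ℝ,
        ContDiffOn ℝ 2 (fun z : ℝ × ℝ => y z.1 z.2) (Set.Ici 0 ×ˢ Set.univ) ∧
        (∀ t, u 0 t = 0) ∧ ∀ x t, x ≠ 0 → u x t = y ‖x‖ t • (‖x‖⁻¹ • x)) ∧
      (∀ b : CurlCurl.E3 → ℝ, ContDiff ℝ 2 b → CurlCurl.RadiallySymmetric b →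
        CurlCurl.IsBreather ρ μ vp vq M p q T γ (CurlCurl.phaseShift u b)) ∧
      Cardinal.continuum ≤ Cardinal.mk
        {v : CurlCurl.E3 → ℝ → CurlCurl.E3 // ∃ b : CurlCurl.E3 → ℝ,
          ContDiff ℝ 2 b ∧ CurlCurl.RadiallySymmetric b ∧ v = CurlCurl.phaseShift u b} := by
  open CurlCurl in
  have hσ : FrequencyProfile q (sigma ρ μ) :=
    .of_mul_lt_one (contDiff_sigma hρ hμ hρ_pos hμ_pos) (fun x => sigma_pos (hρ_pos x) (hμ_pos x))
      (hp.trans hpq) hH1 hH2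
  have hσ_rad := radiallySymmetric_sigma hρ_rad hμ_rad
  have hτ := contDiff_tau (q := q) hμ hvq hμ_pos hvq_pos
  have hτ_pos (x) : 0 < tau μ vq q x := tau_pos (hμ_pos x) (hvq_pos x)
  have hτ_rad := radiallySymmetric_tau (q := q) hμ_rad hvq_rad
  simp only [hσ.map_zero, one_mul] at hH3
  rw [hσ.map_zero, mul_one] at hT
  have hbreather : IsBreather ρ μ vp vq M p q T γ (radialWave p q (tau μ vq q) (sigma ρ μ)) :=
    hT ▸ isBreather_radialWave hp hpq hτ hτ_pos hτ_rad hH4 hσ hσ_rad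
      (fun x => mul_sigma_sq (hρ_pos x) (hμ_pos x))
      (fun x => mul_tau_rpow (hμ_pos x) (hvq_pos x) (hp.trans hpq) (hV x))
      (fun x => mul_tau_rpow_self (hμ_pos x) (hvq_pos x) (hp.trans hpq)) hγ hH3
  obtain ⟨y, hy, hy_eq⟩ := exists_contDiff_eq_norm (flatOn_profile hp hpq hτ hσ).contDiff
    (radiallySymmetric_profile hτ_rad hσ_rad)
  obtain ⟨x, hx⟩ := exists_ne (0 : E3)
  refine ⟨?_, _, hbreather, ⟨y, hy.contDiffOn, radialWave_zero, fun x t _ => ?_⟩,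
    fun b hb hb_rad => hbreather.phaseShift (curl_radialWave hp hpq hτ hτ_rad hσ hσ_rad) hb
      (curl_phaseShift_radialWave hp hpq hτ hτ_rad hσ hσ_rad hb hb_rad),
    (continuum_le_mk_range_radialWave hp hpq hτ_pos hσ hx).trans
      (mk_range_le_mk_phaseShift _ x)⟩
  · rw [hT, ← inv_div, Real.sqrt_eq_one.1 hσ.map_zero, inv_one, Real.sqrt_one, mul_one]
  · rw [radialWave, hy_eq, radialUnit]
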